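/- Let $\Delta$ be a veering triangulation of a connected oriented 3-manifold with finitely many tetrahedra, that is, an oriented ideal triangulation with a transverse taut structure (each tetrahedron has exactly two dihedral angles labelled $\pi$, at opposite edges, and the others are labelled $0$; the angle sum around each edge is $2\pi$; the faces are cooriented so that at each $0$-labelled edge of a tetrahedron exactly one of the two adjacent faces is cooriented inwards) and a colouring of the edges by red and blue such that, looking at any tetrahedron with a $\pi$-labelled edge in front, the four outer $0$-labelled edges, starting from an end of the front edge and going counter-clockwise, are red, blue, red, blue. Let $N$ be the number of tetrahedra. At an (ideal) vertex $T$ of $\Delta$, consider the boundary triangulation of the link of $T$, whose vertices are the ends of edges of $\Delta$ at $T$ and inherit their colours, and whose edges inherit the coorientations of the faces, which we take to point upwards. The *ladderpole curves* at $T$ are the curves formed by the edges of the boundary triangulation whose two ends have the same colour; each vertex of the boundary triangulation lies on exactly one of them. They are red or blue, alternate in colour, and are cyclically ordered from left to right (seen from $T$); there are $2n_T$ of them for some $n_T\ge 1$, the *ladderpole multiplicity* of $T$. Let $\nu=\max_T n_T$. A *red edge sequence* of period $P\ge 1$ is a cyclic sequence $(e_i)_{i\in\mathbb Z/P}$ of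 red oriented edges of $\Delta$ with vertices $(T_i)$ such that $e_i$ goes from $T_{i-1}$ to $T_i$, together with, for each $i$, one of the following two cases, which holds at $i$: (1) the terminal end of $e_i$ and the initial end of $e_{i+1}$ lie on the same ladderpole curve at $T_i$; (2) the initial end of $e_{i+1}$ lies on the ladderpole curve two to the left of that of the terminal end of $e_i$ at $T_i$. (If $n_{T_i}=1$ both conditions hold, and the case is a choice.) Case (1) is required to occur for at least one $i$. In case (2) we say that the sequence crosses, at $T_i$, the blue ladderpole curve next on the left to the red one of the terminal end of $e_i$; the number of times the sequence crosses a blue ladderpole curve $l$ is the number of indices $i$ at which it crosses $l$. Let $d_1,\dots,d_M$ be a finite collection (repetitions allowed) of red oriented edges of $\Delta$ that is *admissible*: at each vertex of $\Delta$ the number of incoming $d_i$ equals the number of outgoing $d_i$. Then there are $k\ge 0$, red oriented edges $d'_1,\dots,d'_k$ and a red edge sequence $(e_1,\dots,e_{M+2k})$ that is a permutation of $(d_1,\dots,d_M,d'_1,\dots,d'_k,-d'_1,\dots,-d'_k)$, where $-d'$ is $d'$ with the reverse orientation. Moreover, for every choice of an integer $\alpha_T\ge 1$ for each vertex $T$,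 these can be chosen such that, for every vertex $T$, the minimum over the blue ladderpole curves $l$ at $T$ of the number of times the sequence crosses $l$ is equal to $\alpha_T$, and such that $$k\le\Bigl(\frac{\nu}{2}M+\max_T\alpha_T+1\Bigr)N+M.$$ -/

import Mathlib

/-- The two colours of the edges of a veering triangulation. -/
inductive EdgeColor : Type
  | red : EdgeColor
  | blue : EdgeColor

/-- An oriented edge of a single tetrahedron with vertices labelled by `Fin 4`: it goes from
the vertex `src` to the vertex `tgt` of the tetrahedron `tet`. -/
@[ext]
structure TetEdge (Tet : Type*) where
  tet : Tet
  src : Fin 4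
  tgt : Fin 4
  ne : src ≠ tgt

/-- The same edge of the tetrahedron with the opposite orientation. -/
def TetEdge.flip {Tet : Type*} (x : TetEdge Tet) : TetEdge Tet :=
  ⟨x.tet, x.tgt, x.src, x.ne.symm⟩

/-- An ideal triangulation of an oriented 3-manifold, given by its set `Tet` of tetrahedra and its
face pairings. The vertices of each tetrahedron are labelled by `Fin 4`, so that the labelling is
positively oriented: seen from vertex `0`, the vertices `1, 2, 3` appear in clockwise order (and
likewise for every even relabelling). The face `f` of a tetrahedron is the one opposite to
its vertex `f`. The face `f` of `t` is glued to the face `glueMap t f f` of `glueTet t f`; a vertex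
`v ≠ f` of this face is glued to the vertex `glueMap t f v`, and the opposite vertices of the two
faces correspond under `glueMap t f`. -/
structure IdealTriangulation (Tet : Type*) where
  glueTet : Tet → Fin 4 → Tet
  glueMap : Tet → Fin 4 → Equiv.Perm (Fin 4)
  /-- Gluing back along the paired face is the inverse gluing. -/
  glueTet_glue : ∀ t f, glueTet (glueTet t f) (glueMap t f f) = t
  glueMap_glue : ∀ t f, glueMap (glueTet t f) (glueMap t f f) = (glueMap t f)⁻¹
  /-- No face is glued to itself. -/
  glue_ne_self : ∀ t f, ¬ (glueTet t f = t ∧ glueMap t f f = f)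
  /-- The gluings are compatible with the orientations of the tetrahedra. -/
  sign_glueMap : ∀ t f, Equiv.Perm.sign (glueMap t f) = -1

namespace IdealTriangulation

variable {Tet : Type*} (D : IdealTriangulation Tet)

/-- The triangulated manifold is connected: any two tetrahedra are joined by a chain of gluings. -/
def Connected : Prop :=
  ∀ s t : Tet, Relation.EqvGen (fun x y : Tet => ∃ f, y = D.glueTet x f) s t

/-- The vertices `x = (t, v)` and `y` of tetrahedra are identified by the gluing of some face of `t`
that contains `v`. -/
def VertexGlued (x y : Tet × Fin 4) : Prop :=
  ∃ f, f ≠ x.2 ∧ y = (D.glueTet x.1 f, D.glueMap x.1 f x.2)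

/-- The (ideal) vertices of the triangulation. -/
def Vertex : Type _ := Quot D.VertexGlued

/-- The oriented edges `x` and `y` of tetrahedra are identified by the gluing of some face of
`x.tet` that contains the edge. -/
def EdgeGlued (x y : TetEdge Tet) : Prop :=
  ∃ f, f ≠ x.src ∧ f ≠ x.tgt ∧
    y = ⟨D.glueTet x.tet f, D.glueMap x.tet f x.src, D.glueMap x.tet f x.tgt,
      (D.glueMap x.tet f).injective.ne x.ne⟩

/-- The oriented edges of the triangulation. -/
def OrientedEdge : Type _ := Quot D.EdgeGlued

/-- The oriented edge of the triangulation given by the edge from `a` to `b` in the tetrahedron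
`t`. -/
def edge (t : Tet) (a b : Fin 4) (h : a ≠ b) : D.OrientedEdge :=
  Quot.mk D.EdgeGlued ⟨t, a, b, h⟩

/-- The edge from the vertex `σ i` to the vertex `σ j` in `t`, for a labelling `σ` of the vertices
of `t`. -/
def edgeAt (t : Tet) (σ : Equiv.Perm (Fin 4)) (i j : Fin 4) (h : i ≠ j := by decide) :
    D.OrientedEdge :=
  D.edge t (σ i) (σ j) (σ.injective.ne h)

variable {D}

/-- The edge with the opposite orientation. -/
def OrientedEdge.rev : D.OrientedEdge → D.OrientedEdge :=
  Quot.map TetEdge.flip (by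
    rintro x y ⟨f, hs, ht, rfl⟩
    exact ⟨f, ht, hs, rfl⟩)

/-- The vertex from which an oriented edge starts. -/
def OrientedEdge.source : D.OrientedEdge → D.Vertex :=
  Quot.lift (fun x => Quot.mk D.VertexGlued (x.tet, x.src)) (by
    rintro x y ⟨f, hs, ht, rfl⟩
    exact Quot.sound ⟨f, hs, rfl⟩)

/-- The vertex at which an oriented edge ends. -/
def OrientedEdge.target (e : D.OrientedEdge) : D.Vertex := e.rev.source

end IdealTriangulation

/-- A transverse taut ideal triangulation. -/
structure TransverseTautTriangulation (Tet : Type*) extends IdealTriangulation Tet where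
  /-- `IsPi t a b`: the dihedral angle of `t` at its edge between `a` and `b` is labelled `π`;
  the other dihedral angles are labelled `0`. -/
  IsPi : Tet → Fin 4 → Fin 4 → Prop
  /-- Exactly two dihedral angles of each tetrahedron are labelled `π`, and these are opposite. -/
  isPi_iff : ∀ t, ∃ σ : Equiv.Perm (Fin 4), ∀ a b,
    IsPi t a b ↔ s(a, b) = s(σ 0, σ 1) ∨ s(a, b) = s(σ 2, σ 3)
  /-- The angle sum around each edge is `2π`, that is, exactly two of the dihedral angles around it
  are labelled `π`. -/
  angle_sum : ∀ e : toIdealTriangulation.OrientedEdge,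
    Nat.card {x : TetEdge Tet //
      Quot.mk toIdealTriangulation.EdgeGlued x = e ∧ IsPi x.tet x.src x.tgt} = 2
  /-- The coorientation of the faces. `Out t f`: the coorientation of the face `f` of `t` points out
  of `t` (otherwise it points into `t`). -/
  Out : Tet → Fin 4 → Prop
  /-- A face is cooriented out of the tetrahedron on one side, and into the one on the other. -/
  out_glue : ∀ t f, Out (glueTet t f) (glueMap t f f) ↔ ¬ Out t f
  /-- At each `0`-labelled edge of a tetrahedron, exactly one of the two adjacent faces is
  cooriented inwards. -/
  out_iff : ∀ t (σ : Equiv.Perm (Fin 4)), ¬ IsPi t (σ 0) (σ 1) → (Out t (σ 2) ↔ ¬ Out t (σ 3))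

/-- A veering triangulation. -/
structure VeeringTriangulation (Tet : Type*) extends TransverseTautTriangulation Tet where
  color : toIdealTriangulation.OrientedEdge → EdgeColor
  /-- The colour belongs to the unoriented edge. -/
  color_rev : ∀ e, color e.rev = color e
  /-- If `σ` is a positively oriented labelling of the vertices of `t` and the edge from `σ 0`
  to `σ 1` is `π`-labelled, then, looking at `t` with this edge in front, the outer vertices are
  `σ 0, σ 2, σ 1, σ 3` in counter-clockwise order. -/
  veering : ∀ t (σ : Equiv.Perm (Fin 4)), Equiv.Perm.sign σ = 1 → IsPi t (σ 0) (σ 1) →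
    color (toIdealTriangulation.edgeAt t σ 0 2) = EdgeColor.red ∧
    color (toIdealTriangulation.edgeAt t σ 2 1) = EdgeColor.blue ∧
    color (toIdealTriangulation.edgeAt t σ 1 3) = EdgeColor.red ∧
    color (toIdealTriangulation.edgeAt t σ 3 0) = EdgeColor.blue

namespace VeeringTriangulation

variable {Tet : Type*} (D : VeeringTriangulation Tet)

/-- The vertices of `D`. -/
abbrev Vert : Type _ := D.toIdealTriangulation.Vertex

/-- The oriented edges of `D`. A vertex of the boundary triangulation at `T` is an end at `T` of an
edge; it is represented by this edge with the orientation that starts at this end. -/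
abbrev OEdge : Type _ := D.toIdealTriangulation.OrientedEdge

/-- The vertices `e` and `e'` of the boundary triangulation have the same colour, and are joined
by an edge of the boundary triangulation, which is the corner at `σ 0` of the face of `t` with
vertices `σ 0, σ 1, σ 2`. -/
def PoleStep (e e' : D.OEdge) : Prop :=
  ∃ (t : Tet) (σ : Equiv.Perm (Fin 4)),
    e = D.edgeAt t σ 0 1 ∧ e' = D.edgeAt t σ 0 2 ∧ D.color e = D.color e'

/-- The ladderpole curves at all vertices of `D`. The ladderpole curves at `T` partition the
vertices of the boundary triangulation at `T`. An edge of the boundary triangulation lies on a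
ladderpole curve if its ends have the same colour, and joins two neighbouring ladderpole curves
otherwise. So the ladderpole curves are the connected components of the graph formed by
the edges of the boundary triangulation with both ends of the same colour. -/
def Ladderpole : Type _ := Quot D.PoleStep

variable {D}

/-- The ladderpole curve determined by a vertex of the boundary triangulation. -/
def pole (e : D.OEdge) : D.Ladderpole := Quot.mk D.PoleStep e

/-- The vertex of `D` at which a ladderpole curve lies. -/
def Ladderpole.vertex : D.Ladderpole → D.Vert :=
  Quot.lift IdealTriangulation.OrientedEdge.source (by
    rintro e e' ⟨t, σ, rfl, rfl, -⟩
    rfl)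

/-- The colour of the vertices on a ladderpole curve. -/
def Ladderpole.color : D.Ladderpole → EdgeColor :=
  Quot.lift D.color (by
    rintro e e' ⟨t, σ, -, -, h⟩
    exact h)

/-- `e` and `e'` have distinct colours and are, respectively, the left and the right end of an edge
of the boundary triangulation, when its coorientation points upwards and one looks at it from the
vertex of `D` (that is, from the inside of its neighbourhood): for a positively oriented labelling
`σ` one sees `σ 1, σ 2, σ 3` in clockwise order from `σ 0`, and, as the face opposite to `σ 3` is
cooriented out of `t`, the third corner `σ 3` is below the edge from `σ 1` to `σ 2`. -/
def LeftRung (e e' : D.OEdge) : Prop :=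
  ∃ (t : Tet) (σ : Equiv.Perm (Fin 4)), Equiv.Perm.sign σ = 1 ∧ D.Out t (σ 3) ∧
    e = D.edgeAt t σ 0 1 ∧ e' = D.edgeAt t σ 0 2 ∧ D.color e ≠ D.color e'

/-- The ladderpole curve `l` is the one next to `l'` on the left. -/
def NextLeft (l l' : D.Ladderpole) : Prop :=
  ∃ e e' : D.OEdge, pole e = l ∧ pole e' = l' ∧ LeftRung e e'

/-- `l` is two ladderpole curves to the left of `l'`. -/
def TwoLeft (l l' : D.Ladderpole) : Prop :=
  ∃ m : D.Ladderpole, NextLeft l m ∧ NextLeft m l'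

variable (D)

/-- The ladderpole multiplicity of `T`: half of the number of ladderpole curves at `T`. -/
noncomputable def ladderpoleMultiplicity (T : D.Vert) : ℕ :=
  Nat.card {l : D.Ladderpole // l.vertex = T} / 2

/-- The maximum `ν` of the ladderpole multiplicities (for finite `Tet`). -/
noncomputable def maxLadderpoleMultiplicity : ℕ :=
  ⨆ T : D.Vert, D.ladderpoleMultiplicity T

/-- A red edge sequence of period `P`, indexed cyclically by `Fin P`, where `finRotate P` is the
cyclic successor. The edge `edge i` arrives at `vert i` through the end `(edge i).rev`. -/
structure RedEdgeSequence (P : ℕ) where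
  edge : Fin P → D.OEdge
  vert : Fin P → D.Vert
  /-- `cross i` says that the second of the two cases applies to `i`. If there is only one red
  ladderpole curve at `vert i`, then the conditions of both cases hold, and so this is a choice. -/
  cross : Fin P → Prop
  color_edge : ∀ i, D.color (edge i) = EdgeColor.red
  target_edge : ∀ i, (edge i).target = vert i
  source_edge : ∀ i, (edge (finRotate P i)).source = vert i
  same_of_not_cross : ∀ i, ¬ cross i → pole (edge (finRotate P i)) = pole (edge i).rev
  left_of_cross : ∀ i, cross i → TwoLeft (pole (edge (finRotate P i))) (pole (edge i).rev)
  exists_not_cross : ∃ i, ¬ cross i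

variable {D}

/-- The number of times a red edge sequence crosses the (blue) ladderpole curve `l`. -/
noncomputable def RedEdgeSequence.crossings {P : ℕ} (S : D.RedEdgeSequence P) (l : D.Ladderpole) :
    ℕ :=
  Nat.card {i : Fin P // S.cross i ∧ NextLeft l (pole (S.edge i).rev)}

/-- An admissible collection of red oriented edges (possibly with repetitions). -/
def RedAdmissible {M : ℕ} (d : Fin M → D.OEdge) : Prop :=
  (∀ i, D.color (d i) = EdgeColor.red) ∧
    ∀ T : D.Vert, Nat.card {i : Fin M // (d i).target = T} =
      Nat.card {i : Fin M // (d i).source = T}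

/-- `S` is an arrangement of the collection that consists of the `d i`, the `d' j` and the reverses
of the `d' j`. -/
def RedEdgeSequence.Arranges {M k P : ℕ} (S : D.RedEdgeSequence P)
    (d : Fin M → D.OEdge) (d' : Fin k → D.OEdge) : Prop :=
  (List.ofFn S.edge).Perm
    (List.ofFn d ++ List.ofFn d' ++ List.ofFn fun j => (d' j).rev)

end VeeringTriangulation

/-!
A triangle of the boundary triangulation points upwards or downwards, and around each vertex the
type changes exactly twice, at the two `π`-angles. All upward triangles at a vertex lie on one side
of its ladderpole curve and all downward ones on the other side, so that every ladderpole curve has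
exactly one neighbour on the left. Passing to it is a permutation of the ladderpole curves that
changes the colour and whose cycles are the vertices of the triangulation.

The required sequence is a cyclic permutation of the edges that matches each arrival at a red
ladderpole curve `r` with a departure on `r` or on the red curve two to the left, the latter `x r`
times. Such a matching, perhaps with several cycles, exists as soon as `x` balances arrivals and
departures at each red curve. By admissibility the balance at a vertex can be solved by a flow with
values in `[0, M]`, normalised by a constant to have minimum `α_T`; only vertices with `n_T ≥ 2`
need a non-constant flow, hence `x r ≤ α_T + ν M / 2`. Adding more copies of every red edge and its
reverse than this, which preserves the balance, leaves at each red curve an arrival that crosses and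
one that does not. Each edge is the bottom `π`-edge of a tetrahedron, which bounds the number of red
edges by `N`.

A matching with the most pairs of edges in a common cycle is a single cycle: exchanging the
successors of two arrivals on one curve, or the departures of two edges starting on one curve, would
merge distinct cycles, and red edges and crossings connect all red ladderpole curves, as a
tetrahedron at a red `π`-edge has its corners joined by red edges, and this property passes from one
tetrahedron to the next across a face.
-/

section Permutations

open Equiv

variable {α β X : Type*}

theorem prop_of_sameCycle [Finite α] {s : Perm α} {p : α → Prop} (hp : ∀ a, p a → p (s a))
    {a b : α} (h : s.SameCycle a b) (ha : p a) : p b := by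
  obtain ⟨n, rfl⟩ := h.exists_nat_pow_eq
  clear h
  induction n with
  | zero => exact ha
  | succ n ih =>
    rw [pow_succ', Perm.mul_apply]
    exact hp _ ih

theorem mul_swap_apply_of_ne [DecidableEq α] (s : Perm α) {a b c : α} (ha : c ≠ a) (hb : c ≠ b) :
    (s * swap a b) c = s c := by
  rw [Perm.mul_apply, swap_apply_of_ne_of_ne ha hb]

theorem sameCycle_mul_swap [Finite α] [DecidableEq α] {s : Perm α} {a b : α}
    (h : ¬ s.SameCycle a b) : (s * swap a b).SameCycle a b := by
  have apply_left : (s * swap a b) a = s b := by simp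
  have along : ∀ c, s.SameCycle b c ∧ (s * swap a b).SameCycle a (s c) →
      s.SameCycle b (s c) ∧ (s * swap a b).SameCycle a (s (s c)) := by
    rintro c ⟨hbc, hac⟩
    have hbsc : s.SameCycle b (s c) := Perm.sameCycle_apply_right.2 hbc
    refine ⟨hbsc, ?_⟩
    by_cases hb : s c = b
    · rw [hb, ← apply_left]
      exact Perm.sameCycle_apply_right.2 (Perm.SameCycle.refl _ _)
    · have ha : s c ≠ a := fun ha => h (ha ▸ hbsc).symm
      rw [← mul_swap_apply_of_ne s ha hb]
      exact Perm.sameCycle_apply_right.2 hac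
  have start : (s * swap a b).SameCycle a (s b) := by
    rw [← apply_left]
    exact Perm.sameCycle_apply_right.2 (Perm.SameCycle.refl _ _)
  have hb : s.SameCycle b (s.symm b) := Perm.sameCycle_apply_right.1 (by simp [Perm.SameCycle.refl])
  simpa using (prop_of_sameCycle along hb ⟨Perm.SameCycle.refl _ _, start⟩).2

theorem sameCycle_mul_swap_of_sameCycle [Finite α] [DecidableEq α] {s : Perm α} {a b x y : α}
    (h : ¬ s.SameCycle a b) (hxy : s.SameCycle x y) : (s * swap a b).SameCycle x y := by
  have hab := sameCycle_mul_swap h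
  have step : ∀ c, (s * swap a b).SameCycle c (s c) := by
    intro c
    by_cases ha : c = a
    · subst ha
      simpa using Perm.sameCycle_apply_right.2 hab
    by_cases hb : c = b
    · subst hb
      simpa using Perm.sameCycle_apply_right.2 hab.symm
    rw [← mul_swap_apply_of_ne s ha hb]
    exact Perm.sameCycle_apply_right.2 (Perm.SameCycle.refl _ _)
  exact prop_of_sameCycle (fun c hc => hc.trans (step c)) hxy (Perm.SameCycle.refl _ _)

theorem exists_mem_forall_sameCycle_of_mul_swap_mem [Finite α] [DecidableEq α] {S : Set (Perm α)}
    (hS : S.Nonempty) : ∃ s ∈ S, ∀ a b, s * swap a b ∈ S → s.SameCycle a b := by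
  -- Maximise the number of pairs of elements in a common cycle.
  obtain ⟨s, hs, hmax⟩ := Set.exists_max_image S
    (fun s => {p : α × α | s.SameCycle p.1 p.2}.ncard) (Set.toFinite S) hS
  refine ⟨s, hs, fun a b hmem => ?_⟩
  by_contra hab
  refine (hmax _ hmem).not_gt (Set.ncard_lt_ncard ⟨?_, fun hsub => ?_⟩ (Set.toFinite _))
  · exact fun p hp => sameCycle_mul_swap_of_sameCycle hab hp
  · exact hab (@hsub (a, b) (sameCycle_mul_swap hab))

theorem exists_equiv_finRotate [Finite α] {n : ℕ} (hn : Nat.card α = n) {s : Perm α}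
    (hs : ∀ a b, s.SameCycle a b) : ∃ φ : Fin n ≃ α, ∀ i, φ (finRotate n i) = s (φ i) := by
  have := Fintype.ofFinite α
  rcases n with _ | n
  · exact ⟨(Finite.equivFinOfCardEq hn).symm, fun i => i.elim0⟩
  obtain ⟨a⟩ : Nonempty α := (Nat.card_pos_iff.1 (by omega)).1
  have isCycleOn : s.IsCycleOn (Finset.univ : Finset α) :=
    ⟨by simp, fun a _ b _ => hs a b⟩
  have pow_eq_iff (k l : ℕ) : (s ^ k) a = (s ^ l) a ↔ k ≡ l [MOD n + 1] := by
    rw [isCycleOn.pow_apply_eq_pow_apply (Finset.mem_univ a), Finset.card_univ,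
      ← Nat.card_eq_fintype_card, hn]
  have injective : Function.Injective fun i : Fin (n + 1) => (s ^ (i : ℕ)) a := fun i j hij =>
    Fin.ext (((pow_eq_iff _ _).1 hij).eq_of_lt_of_lt i.2 j.2)
  have bijective := (Nat.bijective_iff_injective_and_card _).2 ⟨injective, by rw [hn, Nat.card_fin]⟩
  refine ⟨Equiv.ofBijective _ bijective, fun i => ?_⟩
  change (s ^ (finRotate (n + 1) i : ℕ)) a = s ((s ^ (i : ℕ)) a)
  rw [← Perm.mul_apply, ← pow_succ', pow_eq_iff, finRotate_apply, Fin.val_add, Fin.val_one']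
  exact (Nat.mod_modEq _ _).trans ((Nat.ModEq.refl _).add (Nat.mod_modEq _ _))

theorem exists_equiv_of_card_fiber_eq [Finite α] [Finite β] (u : α → X) (v : β → X)
    (h : ∀ r, Nat.card {a // u a = r} = Nat.card {b // v b = r}) :
    ∃ s : α ≃ β, ∀ a, v (s a) = u a := by
  have e : ∀ r, {a // u a = r} ≃ {b // v b = r} := fun r =>
    (Finite.equivFin _).trans ((finCongr (h r)).trans (Finite.equivFin _).symm)
  exact ⟨(sigmaFiberEquiv u).symm.trans ((sigmaCongrRight e).trans (sigmaFiberEquiv v)),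
    fun a => (e (u a) ⟨a, rfl⟩).2⟩

/-- The set `A` is the path from `a` to `b` in the cycle, without its end `b`. -/
theorem exists_path_of_sameCycle [Finite α] {s : Perm α} {a b : α} (h : s.SameCycle a b) :
    ∃ A : Set α, b ∉ A ∧ a ∉ s '' A ∧ insert b A = insert a (s '' A) := by
  classical
  let n := Nat.find h.exists_nat_pow_eq
  have hn : (s ^ n) a = b := Nat.find_spec h.exists_nat_pow_eq
  have hmin : ∀ k < n, (s ^ k) a ≠ b := fun k hk => Nat.find_min h.exists_nat_pow_eq hk
  refine ⟨(fun k => (s ^ k) a) '' Set.Iio n, ?_, ?_, ?_⟩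
  · rintro ⟨k, hk, hkb⟩
    exact hmin k hk hkb
  · rintro ⟨_, ⟨k, hk, rfl⟩, hka⟩
    rw [Set.mem_Iio] at hk
    have hka : (s ^ (k + 1)) a = a := by rwa [pow_succ', Perm.mul_apply]
    refine hmin (n - (k + 1)) (by omega) ?_
    rw [← hn, ← Nat.sub_add_cancel (show k + 1 ≤ n from hk), pow_add, Perm.mul_apply, hka,
      Nat.add_sub_cancel]
  · have hIic : Set.Iic n = insert 0 (Nat.succ '' Set.Iio n) := by
      ext k
      cases k <;> simp
    have himage : s '' ((fun k => (s ^ k) a) '' Set.Iio n) =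
        (fun k => (s ^ k) a) '' (Nat.succ '' Set.Iio n) := by
      simp only [Set.image_image, pow_succ', Perm.mul_apply]
    calc insert b ((fun k => (s ^ k) a) '' Set.Iio n)
        = (fun k => (s ^ k) a) '' Set.Iic n := by rw [← Set.Iio_insert, Set.image_insert_eq, hn]
      _ = insert a (s '' ((fun k => (s ^ k) a) '' Set.Iio n)) := by
          rw [hIic, Set.image_insert_eq, himage, pow_zero, Perm.one_apply]

theorem apply_eq_of_sameCycle_of_subsingleton_change [Finite α]
    {s : Perm α} {u : α → β} {p : α → Prop}
    (step : ∀ a, (p a ↔ p (s a)) → u (s a) = u a)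
    (unique : ∀ a b, s.SameCycle a b → (p a ↔ p b) → ¬ (p a ↔ p (s a)) → ¬ (p b ↔ p (s b)) → a = b)
    {a b : α} (h : s.SameCycle a b) (hp : p a ↔ p b) : u a = u b := by
  have exists_change {a b} (h : s.SameCycle a b) (hne : u b ≠ u a) :
      ∃ c, s.SameCycle a c ∧ u c = u a ∧ (p c ↔ p a) ∧ ¬ (p c ↔ p (s c)) := by
    by_contra! hno
    refine hne (prop_of_sameCycle (p := fun c => s.SameCycle a c ∧ u c = u a ∧ (p c ↔ p a))
      (fun c ⟨hc, huc, hpc⟩ => ?_) h ⟨.refl _ _, rfl, Iff.rfl⟩).2.1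
    have hstep := hno c hc huc hpc
    exact ⟨Perm.sameCycle_apply_right.2 hc, (step c hstep).trans huc, hstep.symm.trans hpc⟩
  -- Otherwise `u` changes between `a` and `b` and between `b` and `a`, both times at a point with
  -- the type `p a` whose successor has the other type; by `unique` these points are the same.
  by_contra hne
  obtain ⟨c, hac, huc, hpc, hc⟩ := exists_change h (Ne.symm hne)
  obtain ⟨d, hbd, hud, hpd, hd⟩ := exists_change h.symm hne
  obtain rfl := unique c d (hac.symm.trans (h.trans hbd)) (hpc.trans (hp.trans hpd.symm)) hc hd
  exact hne (huc.symm.trans hud)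

end Permutations

section Counting

variable {α β X V ι : Type*}

theorem card_subtype_or_of_disjoint [Finite α] {p q : α → Prop} (h : ∀ a, p a → ¬ q a) :
    Nat.card {a // p a ∨ q a} = Nat.card {a // p a} + Nat.card {a // q a} := by
  classical
  have := Fintype.ofFinite α
  simp only [Nat.card_eq_fintype_card]
  exact Fintype.card_subtype_or_disjoint p q
    (Pi.disjoint_iff.2 fun a => Prop.disjoint_iff.2 (not_and.2 (h a)))

theorem card_subtype_sum [Finite α] [Finite β] (p : α ⊕ β → Prop) :
    Nat.card {x // p x} = Nat.card {a // p (Sum.inl a)} + Nat.card {b // p (Sum.inr b)} := by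
  rw [Nat.card_congr Equiv.subtypeSum, Nat.card_sum]

theorem exists_card_fiber_and_eq {u : α → X} {x : X → ℕ}
    (h : ∀ r, x r ≤ Nat.card {a // u a = r}) :
    ∃ c : α → Prop, ∀ r, Nat.card {a // u a = r ∧ c a} = x r := by
  choose s hs hcard using fun r =>
    (Set.exists_subset_card_eq (h r) : ∃ s ⊆ {a | u a = r}, s.ncard = x r)
  refine ⟨fun a => a ∈ s (u a), fun r => ?_⟩
  have : {a | u a = r ∧ a ∈ s (u a)} = s r := by
    ext a
    exact ⟨fun ⟨har, ha⟩ => har ▸ ha, fun ha => ⟨hs r ha, (hs r ha : u a = r).symm ▸ ha⟩⟩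
  rw [← hcard r, ← this]
  rfl

theorem exists_flow [Finite X] [Finite ι] {s : Equiv.Perm X} {v : X → V}
    (hv : ∀ a b, v a = v b → s.SameCycle a b) {p q : ι → X}
    (hpq : ∀ T, Nat.card {i // v (p i) = T} = Nat.card {i // v (q i) = T}) :
    ∃ h : X → ℕ, (∀ a, h a ≤ Nat.card ι) ∧
      ∀ a, Nat.card {i // p i = s a} + h a = Nat.card {i // q i = s a} + h (s a) := by
  -- Match `p i` with some `q (g i)` in its cycle and send one unit along the path between them.
  obtain ⟨g, hg⟩ := exists_equiv_of_card_fiber_eq (fun i => v (p i)) (fun i => v (q i)) hpq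
  choose A hqA hpA hA using fun i => exists_path_of_sameCycle (hv (p i) (q (g i)) (hg i).symm)
  refine ⟨fun a => Nat.card {i // a ∈ A i}, fun a => Finite.card_subtype_le _, fun a => ?_⟩
  have reindex : Nat.card {i // q i = s a} = Nat.card {i // q (g i) = s a} :=
    (Nat.card_congr (g.subtypeEquiv fun i => Iff.rfl)).symm
  have disjoint_p (i) (hi : p i = s a) : a ∉ A i := fun ha => hpA i ⟨a, ha, hi.symm⟩
  have disjoint_q (i) (hi : q (g i) = s a) : s a ∉ A i := hi ▸ hqA i
  rw [reindex, ← card_subtype_or_of_disjoint disjoint_p, ← card_subtype_or_of_disjoint disjoint_q]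
  refine Nat.card_congr (Equiv.subtypeEquivRight fun i => ?_)
  have := Set.ext_iff.1 (hA i) (s a)
  rw [Set.mem_insert_iff, Set.mem_insert_iff, s.injective.mem_set_image] at this
  rw [eq_comm, ← this, eq_comm]

theorem exists_flow_isLeast [Finite X] [Finite ι] {s : Equiv.Perm X} {v : X → V}
    (hv : ∀ a b, s.SameCycle a b ↔ v a = v b) {p q : ι → X}
    (hpq : ∀ T, Nat.card {i // v (p i) = T} = Nat.card {i // v (q i) = T}) (m : V → ℕ) :
    ∃ h : X → ℕ, (∀ a, h a ≤ m (v a) + Nat.card ι) ∧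
      (∀ a, IsLeast (h '' {b | v b = v a}) (m (v a))) ∧
      ∀ a, Nat.card {i // p i = s a} + h a = Nat.card {i // q i = s a} + h (s a) := by
  obtain ⟨h, hle, hflow⟩ := exists_flow (fun a b => (hv a b).2) hpq
  have hmin (a) : ∃ b, v b = v a ∧ ∀ c, v c = v a → h b ≤ h c :=
    Set.exists_min_image {b | v b = v a} h (Set.toFinite _) ⟨a, rfl⟩
  choose b hvb hb using hmin
  have h_b_eq {a a'} (haa' : v a = v a') : h (b a) = h (b a') :=
    le_antisymm (hb _ _ ((hvb a').trans haa'.symm)) (hb _ _ ((hvb a).trans haa'))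
  refine ⟨fun a => h a - h (b a) + m (v a), fun a => ?_, fun a => ⟨?_, ?_⟩, fun a => ?_⟩
  · have := hle a
    dsimp only
    omega
  · exact ⟨b a, hvb a, by simp only [hvb a, h_b_eq (hvb a), Nat.sub_self, Nat.zero_add]⟩
  · rintro _ ⟨c, hc : v c = v a, rfl⟩
    simp only [hc, le_add_iff_nonneg_left, zero_le]
  · have hva : v (s a) = v a := (hv _ _).1 (Equiv.Perm.sameCycle_apply_left.2 (.refl _ _))
    have := hflow a
    have := hb a a rfl
    have := hb a (s a) hva
    simp only [hva, h_b_eq hva]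
    omega

end Counting

section Arrangement

variable {E X : Type*}

/-- A cyclic arrangement, or several: each edge `e`, which goes from `out e` to `inn e`, is followed
by the edge `s e`, which starts at `inn e`, or at `f (inn e)` if `e` is one of the edges with a
crossing, selected by `c`. There are `x r` crossings at `r`. -/
structure IsArrangement (inn out : E → X) (f : X → X) (x : X → ℕ) (s : Equiv.Perm E)
    (c : E → Prop) : Prop where
  out_of_not_cross : ∀ e, ¬ c e → out (s e) = inn e
  out_of_cross : ∀ e, c e → out (s e) = f (inn e)
  card_cross : ∀ r, Nat.card {e // inn e = r ∧ c e} = x r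

/-- The points `a` and `b` are joined by an edge or by a crossing. -/
def Linked (inn out : E → X) (f : X → X) (a b : X) : Prop :=
  f a = b ∨ ∃ e, out e = a ∧ inn e = b

namespace IsArrangement

variable {inn out : E → X} {f : X → X} {x : X → ℕ} {s : Equiv.Perm E} {c : E → Prop}

theorem mul_swap_of_inn_eq [DecidableEq E] (h : IsArrangement inn out f x s c) {a b : E}
    (hab : inn a = inn b) :
    IsArrangement inn out f x (s * Equiv.swap a b) (c ∘ Equiv.swap a b) where
  out_of_not_cross e he := by
    rw [Equiv.Perm.mul_apply, h.out_of_not_cross _ he, Equiv.apply_swap_eq_self hab]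
  out_of_cross e he := by
    rw [Equiv.Perm.mul_apply, h.out_of_cross _ he, Equiv.apply_swap_eq_self hab]
  card_cross r := by
    rw [← h.card_cross r]
    exact Nat.card_congr ((Equiv.swap a b).subtypeEquiv fun e => by
      rw [Equiv.apply_swap_eq_self hab, Function.comp_apply])

theorem mul_swap_of_out_eq [DecidableEq E] (h : IsArrangement inn out f x s c) {a b : E}
    (hab : out (s a) = out (s b)) : IsArrangement inn out f x (s * Equiv.swap a b) c where
  out_of_not_cross e he := by
    exact (Equiv.apply_swap_eq_self (v := out ∘ s) hab e).trans (h.out_of_not_cross e he)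
  out_of_cross e he := by
    exact (Equiv.apply_swap_eq_self (v := out ∘ s) hab e).trans (h.out_of_cross e he)
  card_cross := h.card_cross

theorem exists_cross (h : IsArrangement inn out f x s c) {r : X} (hr : 0 < x r) :
    ∃ e, inn e = r ∧ c e := by
  rw [← h.card_cross r] at hr
  obtain ⟨⟨e, he⟩⟩ := (Nat.card_pos_iff.1 hr).1
  exact ⟨e, he⟩

theorem exists_not_cross (h : IsArrangement inn out f x s c) {r : X}
    (hr : x r < Nat.card {e // inn e = r}) : ∃ e, inn e = r ∧ ¬ c e := by
  by_contra! hall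
  rw [← h.card_cross r] at hr
  exact hr.ne (Nat.card_congr (Equiv.subtypeEquivRight fun e =>
    ⟨fun he => he.1, fun he => ⟨he, hall e he⟩⟩))

theorem sameCycle_of_eqvGen (h : IsArrangement inn out f x s c) (hpos : ∀ r, 0 < x r)
    (hlt : ∀ r, x r < Nat.card {e // inn e = r})
    (hinn : ∀ a b, inn a = inn b → s.SameCycle a b)
    (hout : ∀ a b, out (s a) = out (s b) → s.SameCycle a b) {a b : E}
    (hab : Relation.EqvGen (Linked inn out f) (inn a) (inn b)) : s.SameCycle a b := by
  choose y hy hcross using fun r => h.exists_cross (hpos r)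
  choose z hz hstay using fun r => h.exists_not_cross (hlt r)
  have inn_out (a b) (hab : inn a = out b) : s.SameCycle a b := by
    have hza : s.SameCycle a (z (inn a)) := hinn _ _ (hz _).symm
    have hzb : s.SameCycle (z (inn a)) (s.symm b) := hout _ _ (by
      rw [h.out_of_not_cross _ (hstay _), hz, hab, Equiv.apply_symm_apply])
    simpa using Equiv.Perm.sameCycle_apply_right.2 (hza.trans hzb)
  have step (r r') (hr : Linked inn out f r r') : s.SameCycle (y r) (y r') := by
    rcases hr with hr | ⟨e, rfl, rfl⟩
    · have := inn_out (y r') (s (y r)) (by rw [h.out_of_cross _ (hcross r), hy, hy, hr])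
      exact (Equiv.Perm.sameCycle_apply_right.1 this).symm
    · exact (inn_out _ _ (hy _)).trans (hinn _ _ (hy _).symm)
  have key : s.SameCycle (y (inn a)) (y (inn b)) :=
    ((Equiv.Perm.SameCycle.equivalence s).comap y).eqvGen_iff.1 (hab.mono step)
  exact (hinn _ _ (hy _).symm).trans (key.trans (hinn _ _ (hy _)))

end IsArrangement

variable {inn out : E → X} {f : Equiv.Perm X} {x : X → ℕ}

theorem exists_isArrangement [Finite E]
    (hbal : ∀ r, Nat.card {e // inn e = f r} + x r = Nat.card {e // out e = f r} + x (f r))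
    (hx : ∀ r, x r ≤ Nat.card {e // inn e = r}) : ∃ s c, IsArrangement inn out f x s c := by
  classical
  obtain ⟨c, hc⟩ := exists_card_fiber_and_eq hx
  have hcard (r) : Nat.card {e // (if c e then f (inn e) else inn e) = r} =
      Nat.card {e // out e = r} := by
    obtain ⟨r, rfl⟩ := f.surjective r
    have arrivals : Nat.card {e // inn e = f r} =
        x (f r) + Nat.card {e // inn e = f r ∧ ¬ c e} := by
      rw [← hc, ← card_subtype_or_of_disjoint (by tauto)]
      exact Nat.card_congr (Equiv.subtypeEquivRight fun e => by tauto)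
    have successors : Nat.card {e // (if c e then f (inn e) else inn e) = f r} =
        x r + Nat.card {e // inn e = f r ∧ ¬ c e} := by
      rw [← hc, ← card_subtype_or_of_disjoint (by tauto)]
      exact Nat.card_congr (Equiv.subtypeEquivRight fun e => by by_cases h : c e <;> simp [h])
    have := hbal r
    omega
  obtain ⟨s, hs⟩ := exists_equiv_of_card_fiber_eq _ out hcard
  exact ⟨s, c, fun e he => by rw [hs, if_neg he], fun e he => by rw [hs, if_pos he], hc⟩

theorem exists_cyclic_isArrangement [Finite E]
    (hbal : ∀ r, Nat.card {e // inn e = f r} + x r = Nat.card {e // out e = f r} + x (f r))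
    (hpos : ∀ r, 0 < x r) (hlt : ∀ r, x r < Nat.card {e // inn e = r})
    (hconn : ∀ r r', Relation.EqvGen (Linked inn out f) r r') :
    ∃ s c, IsArrangement inn out f x s c ∧ ∀ e e', s.SameCycle e e' := by
  classical
  obtain ⟨s₀, c₀, h₀⟩ := exists_isArrangement hbal fun r => (hlt r).le
  obtain ⟨s, ⟨c, hs⟩, hmerged⟩ := exists_mem_forall_sameCycle_of_mul_swap_mem
    (S := {s | ∃ c, IsArrangement inn out f x s c}) ⟨s₀, c₀, h₀⟩
  exact ⟨s, c, hs, fun e e' => hs.sameCycle_of_eqvGen hpos hlt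
    (fun a b hab => hmerged a b ⟨_, hs.mul_swap_of_inn_eq hab⟩)
    (fun a b hab => hmerged a b ⟨_, hs.mul_swap_of_out_eq hab⟩) (hconn _ _)⟩

end Arrangement

/-! ### Flags and the tetrahedra around an edge -/

namespace EdgeColor

/-- The colour different from a given one. -/
def other : EdgeColor → EdgeColor
  | red => blue
  | blue => red

theorem other_other (c : EdgeColor) : c.other.other = c := by
  cases c <;> rfl

theorem ne_iff_eq_other {c c' : EdgeColor} : c ≠ c' ↔ c = c'.other := by
  cases c <;> cases c' <;> simp [other]

theorem eq_or_eq_of_ne {c c' : EdgeColor} (h : c ≠ c') (d : EdgeColor) : d = c ∨ d = c' := by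
  cases c <;> cases c' <;> cases d <;> simp_all

end EdgeColor

theorem perm_fin_four_eq_of_sign_eq {σ τ : Equiv.Perm (Fin 4)}
    (hsign : Equiv.Perm.sign σ = Equiv.Perm.sign τ) (h0 : σ 0 = τ 0) (h1 : σ 1 = τ 1) : σ = τ := by
  have key : ∀ ρ : Equiv.Perm (Fin 4), Equiv.Perm.sign ρ = 1 → ρ 0 = 0 → ρ 1 = 1 → ρ = 1 := by
    decide
  refine (inv_mul_eq_one.1 (key (σ⁻¹ * τ) ?_ ?_ ?_))
  · rw [map_mul, map_inv, hsign, inv_mul_cancel]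
  · rw [Equiv.Perm.mul_apply, ← h0, Equiv.Perm.inv_eq_iff_eq]
  · rw [Equiv.Perm.mul_apply, ← h1, Equiv.Perm.inv_eq_iff_eq]

theorem sign_mul_swap_eq_one {α : Type*} [Fintype α] [DecidableEq α] {σ : Equiv.Perm α} {i j : α}
    (hij : i ≠ j) (h : Equiv.Perm.sign σ = -1) :
    Equiv.Perm.sign (σ * Equiv.swap i j) = 1 := by
  rw [map_mul, h, Equiv.Perm.sign_swap hij, neg_mul_neg, one_mul]

/-- A positively oriented labelling of the vertices of a tetrahedron. It stands for the oriented
edge from `label 0` to `label 1`, seen in front, and, as this edge determines the labelling, also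
for the corner at `label 0` of the face with vertices `label 0, label 1, label 2`. -/
@[ext]
structure TetFlag (Tet : Type*) where
  tet : Tet
  label : Equiv.Perm (Fin 4)
  sign_label : Equiv.Perm.sign label = 1

instance {Tet : Type*} [Finite Tet] : Finite (TetEdge Tet) :=
  Finite.of_injective (fun x => (x.tet, x.src, x.tgt)) fun x y h => by
    simp only [Prod.mk.injEq] at h
    exact TetEdge.ext h.1 h.2.1 h.2.2

namespace TetFlag

variable {Tet : Type*}

/-- The edge of the tetrahedron in front. -/
def tetEdge (s : TetFlag Tet) : TetEdge Tet :=
  ⟨s.tet, s.label 0, s.label 1, s.label.injective.ne (by decide)⟩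

theorem tetEdge_bijective : Function.Bijective (tetEdge : TetFlag Tet → TetEdge Tet) := by
  constructor
  · rintro ⟨t, σ, hσ⟩ ⟨t', τ, hτ⟩ h
    simp only [tetEdge, TetEdge.mk.injEq] at h
    obtain ⟨rfl, h0, h1⟩ := h
    obtain rfl := perm_fin_four_eq_of_sign_eq (hσ.trans hτ.symm) h0 h1
    rfl
  · rintro ⟨t, a, b, hab⟩
    have exists_even : ∀ a b : Fin 4, a ≠ b →
        ∃ σ : Equiv.Perm (Fin 4), Equiv.Perm.sign σ = 1 ∧ σ 0 = a ∧ σ 1 = b := by decide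
    obtain ⟨σ, hσ, rfl, rfl⟩ := exists_even a b hab
    exact ⟨⟨t, σ, hσ⟩, rfl⟩

instance [Finite Tet] : Finite (TetFlag Tet) :=
  Finite.of_injective _ tetEdge_bijective.1

/-- The corner of the tetrahedron at the source of the front edge. -/
def corner (s : TetFlag Tet) : Tet × Fin 4 := (s.tet, s.label 0)

/-- The flag at the same corner whose front edge is the one from `label 0` to `label 2`. -/
def rot (s : TetFlag Tet) : TetFlag Tet where
  tet := s.tet
  label := s.label * (Equiv.swap 1 2 * Equiv.swap 2 3)
  sign_label := by
    rw [map_mul, s.sign_label, one_mul]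
    decide

theorem rot_rot_rot (s : TetFlag Tet) : s.rot.rot.rot = s :=
  tetEdge_bijective.1 rfl

theorem eq_of_corner_eq {s s' : TetFlag Tet} (h : s.corner = s'.corner) :
    s' = s ∨ s' = s.rot ∨ s' = s.rot.rot := by
  have h0 := congrArg Prod.snd h
  obtain ⟨i, hi⟩ := s.label.surjective (s'.label 1)
  have eq_of_label_one {r : TetFlag Tet} (hr : r.corner = s.corner) (h1 : r.label 1 = s.label i) :
      s' = r :=
    tetEdge_bijective.1 (TetEdge.ext (congrArg Prod.fst (hr.trans h)).symm
      (congrArg Prod.snd (hr.trans h)).symm (h1.trans hi).symm)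
  fin_cases i
  · exact absurd (s'.label.injective (h0.symm.trans hi)) (by decide)
  · exact Or.inl (eq_of_label_one rfl rfl)
  · exact Or.inr (Or.inl (eq_of_label_one rfl rfl))
  · exact Or.inr (Or.inr (eq_of_label_one rfl rfl))

theorem exists_corner_eq_and_label_three_eq {x : Tet × Fin 4} {f : Fin 4} (hf : f ≠ x.2) :
    ∃ s : TetFlag Tet, s.corner = x ∧ s.label 3 = f := by
  obtain ⟨s, hs⟩ := tetEdge_bijective.2 ⟨x.1, x.2, f, hf.symm⟩
  obtain ⟨ht, h0, h1⟩ := (TetEdge.mk.injEq ..).mp hs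
  exact ⟨s.rot, Prod.ext ht h0, h1⟩

end TetFlag

namespace IdealTriangulation

variable {Tet : Type*} (D : IdealTriangulation Tet)

/-- The vertex of the triangulation at a corner of a tetrahedron. -/
def vertexAt (x : Tet × Fin 4) : D.Vertex := Quot.mk D.VertexGlued x

/-- The oriented edge of the triangulation in front. -/
def front (s : TetFlag Tet) : D.OrientedEdge := Quot.mk D.EdgeGlued s.tetEdge

/-- The flag with the glued front edge in the tetrahedron across the face opposite to `label i`,
for `i = 2` or `i = 3`; the labels `2` and `3` are exchanged because gluings reverse the
orientation. -/
def acrossFace (s : TetFlag Tet) (i : Fin 4) : TetFlag Tet where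
  tet := D.glueTet s.tet (s.label i)
  label := D.glueMap s.tet (s.label i) * s.label * Equiv.swap 2 3
  sign_label := sign_mul_swap_eq_one (by decide) (by
    rw [map_mul, D.sign_glueMap, s.sign_label, mul_one])

theorem acrossFace_acrossFace (s : TetFlag Tet) (i : Fin 4) :
    D.acrossFace (D.acrossFace s i) (Equiv.swap 2 3 i) = s := by
  have hface : (D.acrossFace s i).label (Equiv.swap 2 3 i) =
      D.glueMap s.tet (s.label i) (s.label i) := by
    simp [acrossFace]
  refine TetFlag.ext ?_ ?_
  · change D.glueTet (D.glueTet s.tet (s.label i)) _ = _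
    rw [hface, D.glueTet_glue]
  · change D.glueMap (D.glueTet s.tet (s.label i)) _ * (_ * _ * _) * _ = _
    rw [hface, D.glueMap_glue]
    simp [mul_assoc]

/-- The rotation of flags around their front edges. -/
def turn : Equiv.Perm (TetFlag Tet) where
  toFun s := D.acrossFace s 3
  invFun s := D.acrossFace s 2
  left_inv s := D.acrossFace_acrossFace s 3
  right_inv s := D.acrossFace_acrossFace s 2

theorem front_turn (s : TetFlag Tet) : D.front (D.turn s) = D.front s :=
  (Quot.sound ⟨s.label 3, s.label.injective.ne (by decide), s.label.injective.ne (by decide), rfl⟩ :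
    D.front s = D.front (D.turn s)).symm

theorem front_turn_rot_rot (s : TetFlag Tet) : D.front (D.turn s).rot.rot = D.front s.rot :=
  (Quot.sound ⟨s.label 3, s.label.injective.ne (by decide), s.label.injective.ne (by decide), rfl⟩ :
    D.front s.rot = D.front (D.turn s).rot.rot).symm

theorem vertexGlued_iff_exists_turn {x y : Tet × Fin 4} :
    D.VertexGlued x y ↔ ∃ s : TetFlag Tet, s.corner = x ∧ (D.turn s).corner = y := by
  constructor
  · rintro ⟨f, hf, rfl⟩
    obtain ⟨s, rfl, rfl⟩ := TetFlag.exists_corner_eq_and_label_three_eq hf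
    exact ⟨s, rfl, rfl⟩
  · rintro ⟨s, rfl, rfl⟩
    exact ⟨s.label 3, s.label.injective.ne (by decide), rfl⟩

theorem eq_turn_or_of_edgeGlued {s s' : TetFlag Tet} (h : D.EdgeGlued s.tetEdge s'.tetEdge) :
    s' = D.turn s ∨ s' = D.turn.symm s := by
  obtain ⟨f, h0, h1, hs'⟩ := h
  obtain ⟨i, rfl⟩ := s.label.surjective f
  have hi0 : i ≠ 0 := fun hi => h0 (hi ▸ rfl)
  have hi1 : i ≠ 1 := fun hi => h1 (hi ▸ rfl)
  obtain rfl | rfl : i = 3 ∨ i = 2 := by omega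
  · exact Or.inl (TetFlag.tetEdge_bijective.1 hs')
  · exact Or.inr (TetFlag.tetEdge_bijective.1 hs')

instance [Finite Tet] : Finite D.Vertex :=
  inferInstanceAs (Finite (Quot D.VertexGlued))

instance [Finite Tet] : Finite D.OrientedEdge :=
  inferInstanceAs (Finite (Quot D.EdgeGlued))

theorem sameCycle_turn_iff [Finite Tet] {s s' : TetFlag Tet} :
    D.turn.SameCycle s s' ↔ D.front s = D.front s' := by
  constructor
  · exact fun h => prop_of_sameCycle (p := fun r => D.front s = D.front r)
      (fun r hr => hr.trans (D.front_turn r).symm) h rfl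
  · intro h
    let flagOf := (Equiv.ofBijective _ (TetFlag.tetEdge_bijective (Tet := Tet))).symm
    have step (x y) (hxy : D.EdgeGlued x y) : D.turn.SameCycle (flagOf x) (flagOf y) := by
      obtain ⟨r, rfl⟩ := flagOf.symm.surjective x
      obtain ⟨r', rfl⟩ := flagOf.symm.surjective y
      rw [Equiv.apply_symm_apply, Equiv.apply_symm_apply]
      rcases D.eq_turn_or_of_edgeGlued hxy with rfl | rfl
      · exact Equiv.Perm.sameCycle_apply_right.2 (.refl _ _)
      · exact Equiv.Perm.sameCycle_apply_right.1 (by simp [Equiv.Perm.SameCycle.refl])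
    have := ((Equiv.Perm.SameCycle.equivalence D.turn).comap flagOf).eqvGen_iff.1
      ((Quot.eqvGen_exact h).mono step)
    simpa [flagOf, Function.onFun, InvImage, Equiv.ofBijective_symm_apply_apply] using this

end IdealTriangulation

namespace TransverseTautTriangulation

variable {Tet : Type*} (D : TransverseTautTriangulation Tet)

theorem isPi_iff_of_isPi {t : Tet} {σ : Equiv.Perm (Fin 4)} (h : D.IsPi t (σ 0) (σ 1))
    (a b : Fin 4) : D.IsPi t a b ↔ s(a, b) = s(σ 0, σ 1) ∨ s(a, b) = s(σ 2, σ 3) := by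
  obtain ⟨τ, hτ⟩ := D.isPi_iff t
  have mk_eq_iff (i j k l : Fin 4) : s(τ i, τ j) = s(τ k, τ l) ↔ s(i, j) = s(k, l) := by
    simp only [Sym2.eq_iff, τ.injective.eq_iff]
  have same_partition : ∀ ρ : Equiv.Perm (Fin 4),
      s(ρ 0, ρ 1) = s(0, 1) ∨ s(ρ 0, ρ 1) = s(2, 3) → ∀ a b : Fin 4,
        (s(a, b) = s(0, 1) ∨ s(a, b) = s(2, 3) ↔
          s(a, b) = s(ρ 0, ρ 1) ∨ s(a, b) = s(ρ 2, ρ 3)) := by decide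
  obtain ⟨ρ, rfl⟩ : ∃ ρ, σ = τ * ρ := ⟨τ⁻¹ * σ, (mul_inv_cancel_left τ σ).symm⟩
  obtain ⟨a, rfl⟩ := τ.surjective a
  obtain ⟨b, rfl⟩ := τ.surjective b
  simp only [hτ, Equiv.Perm.mul_apply, mk_eq_iff] at h ⊢
  exact same_partition ρ h a b

theorem exists_isPi (t : Tet) (a : Fin 4) : ∃ b, a ≠ b ∧ D.IsPi t a b := by
  obtain ⟨σ, hσ⟩ := D.isPi_iff t
  obtain ⟨i, rfl⟩ := σ.surjective a
  have opposite (j : Fin 4) (hij : i ≠ j) (h : s(i, j) = s(0, 1) ∨ s(i, j) = s(2, 3)) :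
      ∃ b, σ i ≠ b ∧ D.IsPi t (σ i) b :=
    ⟨σ j, σ.injective.ne hij,
      (hσ _ _).2 (h.imp (congrArg (Sym2.map σ)) (congrArg (Sym2.map σ)))⟩
  fin_cases i
  · exact opposite 1 (by decide) (by decide)
  · exact opposite 0 (by decide) (by decide)
  · exact opposite 3 (by decide) (by decide)
  · exact opposite 2 (by decide) (by decide)

/-- The front edge is `π`-labelled. -/
def FrontPi (s : TetFlag Tet) : Prop := D.IsPi s.tet (s.label 0) (s.label 1)

/-- The face opposite to `label i` is cooriented outwards. -/
def OutAt (s : TetFlag Tet) (i : Fin 4) : Prop := D.Out s.tet (s.label i)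

/-- The triangle of the boundary triangulation that cuts off a corner points upwards: two of its
sides are cooriented outwards, and they meet at its vertex with angle `π`. -/
def Upward (x : Tet × Fin 4) : Prop := ¬ D.Out x.1 x.2

variable {D}

theorem FrontPi.outAt_iff {s : TetFlag Tet} (h : D.FrontPi s) :
    (D.OutAt s 1 ↔ ¬ D.Upward s.corner) ∧ (D.OutAt s 2 ↔ D.Upward s.corner) ∧
      (D.OutAt s 3 ↔ D.Upward s.corner) := by
  have h02 : ¬ D.IsPi s.tet (s.label 0) (s.label 2) := by
    simp [D.isPi_iff_of_isPi h, s.label.injective.eq_iff]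
  have h03 : ¬ D.IsPi s.tet (s.label 0) (s.label 3) := by
    simp [D.isPi_iff_of_isPi h, s.label.injective.eq_iff]
  have h12 : ¬ D.IsPi s.tet (s.label 1) (s.label 2) := by
    simp [D.isPi_iff_of_isPi h, s.label.injective.eq_iff]
  have out13 : D.OutAt s 1 ↔ ¬ D.OutAt s 3 := (D.out_iff s.tet (s.label * Equiv.swap 1 2) h02 :)
  have out12 : D.OutAt s 1 ↔ ¬ D.OutAt s 2 :=
    (D.out_iff s.tet (s.label * (Equiv.swap 1 3 * Equiv.swap 2 3)) h03 :)
  have out03 : D.OutAt s 0 ↔ ¬ D.OutAt s 3 :=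
    (D.out_iff s.tet (s.label * (Equiv.swap 0 1 * Equiv.swap 1 2)) h12 :)
  have upward_iff : D.Upward s.corner ↔ ¬ D.OutAt s 0 := Iff.rfl
  tauto

variable (D)

theorem exists_frontPi_corner (x : Tet × Fin 4) :
    ∃ s : TetFlag Tet, s.corner = x ∧ D.FrontPi s := by
  obtain ⟨t, a⟩ := x
  obtain ⟨b, hb, hpi⟩ := D.exists_isPi t a
  obtain ⟨s, hs⟩ := TetFlag.tetEdge_bijective.2 ⟨t, a, b, hb⟩
  obtain ⟨rfl, rfl, rfl⟩ := (TetEdge.mk.injEq ..).mp hs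
  exact ⟨s, rfl, hpi⟩

theorem outAt_two_turn (s : TetFlag Tet) : D.OutAt (D.turn s) 2 ↔ ¬ D.OutAt s 3 :=
  D.out_glue s.tet (s.label 3)

theorem outAt_three_turn_iff (s : TetFlag Tet) :
    (D.OutAt (D.turn s) 3 ↔ D.OutAt s 3) ↔ ¬ D.FrontPi (D.turn s) := by
  have htwo := D.outAt_two_turn s
  by_cases hpi : D.FrontPi (D.turn s)
  · have := hpi.outAt_iff
    tauto
  · have : D.OutAt (D.turn s) 2 ↔ ¬ D.OutAt (D.turn s) 3 := D.out_iff _ _ hpi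
    tauto

theorem card_frontPi (e : D.OrientedEdge) :
    Nat.card {s : TetFlag Tet // D.front s = e ∧ D.FrontPi s} = 2 := by
  rw [← D.angle_sum e]
  exact Nat.card_congr
    ((Equiv.ofBijective _ TetFlag.tetEdge_bijective).subtypeEquiv fun _ => Iff.rfl)

variable [Finite Tet]

theorem exists_opposite_frontPi {s : TetFlag Tet} (hs : D.FrontPi s) :
    ∃ r, D.front r = D.front s ∧ D.FrontPi r ∧ (D.OutAt r 3 ↔ ¬ D.OutAt s 3) := by
  by_contra! hno
  have along (r : TetFlag Tet) (hr : D.front r = D.front s ∧ (D.OutAt r 3 ↔ D.OutAt s 3)) :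
      D.front (D.turn r) = D.front s ∧ (D.OutAt (D.turn r) 3 ↔ D.OutAt s 3) := by
    have hfront : D.front (D.turn r) = D.front s := (D.front_turn r).trans hr.1
    have := hno _ hfront
    have := D.outAt_three_turn_iff r
    tauto
  obtain ⟨r, rfl⟩ := D.turn.surjective s
  have hr := (prop_of_sameCycle along
    (Equiv.Perm.sameCycle_apply_left.2 (.refl _ r)) ⟨rfl, Iff.rfl⟩).2
  exact (D.outAt_three_turn_iff r).1 hr.symm hs

theorem existsUnique_frontPi (e : D.OrientedEdge) (p : Prop) :
    ∃! s, D.front s = e ∧ D.FrontPi s ∧ (D.OutAt s 3 ↔ p) := by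
  obtain ⟨⟨a, rfl, ha⟩, ⟨b, hb, hbpi⟩, -, hab⟩ := Nat.card_eq_two_iff.1 (D.card_frontPi e)
  have eq_or (s) (hs : D.front s = D.front a) (hpi : D.FrontPi s) : s = a ∨ s = b := by
    have : (⟨s, hs, hpi⟩ : {s // D.front s = D.front a ∧ D.FrontPi s}) ∈ Set.univ :=
      Set.mem_univ _
    rw [← hab] at this
    simpa using this
  have hout : D.OutAt b 3 ↔ ¬ D.OutAt a 3 := by
    obtain ⟨r, hr, hrpi, hrout⟩ := D.exists_opposite_frontPi ha
    rcases eq_or r hr hrpi with rfl | rfl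
    · exact absurd hrout (by tauto)
    · exact hrout
  by_cases hp : D.OutAt a 3 ↔ p
  · refine ⟨a, ⟨rfl, ha, hp⟩, fun s hs => (eq_or s hs.1 hs.2.1).resolve_right ?_⟩
    rintro rfl
    tauto
  · refine ⟨b, ⟨hb, hbpi, by tauto⟩, fun s hs => (eq_or s hs.1 hs.2.1).resolve_left ?_⟩
    rintro rfl
    tauto

theorem exists_front_upward (e : D.OrientedEdge) (p : Prop) :
    ∃ s, D.front s = e ∧ (D.Upward s.corner ↔ p) := by
  obtain ⟨s, ⟨hs, hpi, hout⟩, -⟩ := D.existsUnique_frontPi e p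
  exact ⟨s, hs, hpi.outAt_iff.2.2.symm.trans hout⟩

end TransverseTautTriangulation

/-! ### Ladderpole curves -/

namespace VeeringTriangulation

variable {Tet : Type*} (D : VeeringTriangulation Tet)

theorem color_of_frontPi {s : TetFlag Tet} (h : D.FrontPi s) :
    D.color (D.front s.rot) = EdgeColor.red ∧ D.color (D.front s.rot.rot) = EdgeColor.blue := by
  obtain ⟨hred, -, -, hblue⟩ := D.veering s.tet s.label s.sign_label h
  exact ⟨hred, (D.color_rev (D.front s.rot.rot)).symm.trans hblue⟩

theorem exists_corner_color (x : Tet × Fin 4) (c : EdgeColor) :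
    ∃ s : TetFlag Tet, s.corner = x ∧ D.color (D.front s) = c := by
  obtain ⟨s, rfl, hs⟩ := D.exists_frontPi_corner x
  cases c
  · exact ⟨s.rot, rfl, (D.color_of_frontPi hs).1⟩
  · exact ⟨s.rot.rot, rfl, (D.color_of_frontPi hs).2⟩

theorem upward_corner_iff (s : TetFlag Tet) : D.Upward s.corner ↔ (D.OutAt s 3 ↔
    ¬ (D.color (D.front s) = EdgeColor.red ∧ D.color (D.front s.rot) = EdgeColor.blue)) := by
  obtain ⟨f, hf, hpi⟩ := D.exists_frontPi_corner s.corner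
  have hout := hpi.outAt_iff
  obtain ⟨hred, hblue⟩ := D.color_of_frontPi hpi
  rw [← hf]
  rcases TetFlag.eq_of_corner_eq hf with rfl | rfl | rfl
  · simp only [hred, reduceCtorEq, and_false, not_false_eq_true, iff_true]
    exact hout.2.2.symm
  · simp only [hred, hblue, and_true, not_true_eq_false, iff_false]
    exact (not_congr hout.1 |>.trans not_not).symm
  · simp only [hblue, reduceCtorEq, false_and, not_false_eq_true, iff_true]
    exact hout.2.1.symm

theorem upward_corner_iff_of_blue {s : TetFlag Tet} (h : D.color (D.front s) = EdgeColor.blue) :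
    D.Upward s.corner ↔ D.OutAt s 3 := by
  simp [D.upward_corner_iff s, h]

theorem upward_corner_iff_of_red {s : TetFlag Tet} (h : D.color (D.front s) = EdgeColor.red) :
    D.Upward s.corner ↔ D.OutAt s 2 := by
  have hrot : D.Upward s.corner ↔ (D.OutAt s 2 ↔ _) := D.upward_corner_iff s.rot.rot
  simpa [s.rot_rot_rot, h] using hrot

theorem upward_turn_iff (s : TetFlag Tet) :
    (D.Upward s.corner ↔ D.Upward (D.turn s).corner) ↔
      D.color (D.front s) ≠ D.color (D.front s.rot) := by
  have hs := D.upward_corner_iff s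
  have hturn : D.Upward (D.turn s).corner ↔ (D.OutAt (D.turn s) 2 ↔ _) :=
    D.upward_corner_iff (D.turn s).rot.rot
  rw [TetFlag.rot_rot_rot, D.front_turn_rot_rot, D.front_turn, D.outAt_two_turn] at hturn
  cases hc : D.color (D.front s) <;> cases hc' : D.color (D.front s.rot) <;>
    simp only [hc, hc', reduceCtorEq, and_false, false_and, and_self, ne_eq, not_false_eq_true,
      not_true_eq_false, iff_true, iff_false] at hs hturn ⊢ <;>
    tauto

theorem exists_rung (x : Tet × Fin 4) : ∃ s : TetFlag Tet, s.corner = x ∧ D.OutAt s 3 ∧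
    D.color (D.front s) ≠ D.color (D.front s.rot) := by
  obtain ⟨s, rfl, hpi⟩ := D.exists_frontPi_corner x
  obtain ⟨hred, hblue⟩ := D.color_of_frontPi hpi
  obtain ⟨hout1, hout2, hout3⟩ := hpi.outAt_iff
  by_cases hup : D.Upward s.corner
  · cases hc : D.color (D.front s)
    · refine ⟨s.rot.rot, rfl, hout2.2 hup, ?_⟩
      rw [s.rot_rot_rot, hblue, hc]
      exact EdgeColor.noConfusion
    · refine ⟨s, rfl, hout3.2 hup, ?_⟩
      rw [hred, hc]
      exact EdgeColor.noConfusion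
  · refine ⟨s.rot, rfl, hout1.2 hup, ?_⟩
    rw [hred, hblue]
    exact EdgeColor.noConfusion

theorem upward_corner_iff_of_rung {s : TetFlag Tet} (hout : D.OutAt s 3)
    (hne : D.color (D.front s) ≠ D.color (D.front s.rot)) :
    D.Upward s.corner ↔ D.color (D.front s.rot) = EdgeColor.red := by
  rw [D.upward_corner_iff s]
  cases hc : D.color (D.front s) <;> cases hc' : D.color (D.front s.rot) <;> simp_all

/-- The ladderpole curve of colour `c` through the triangle of the boundary triangulation that cuts
off the corner `x`. -/
noncomputable def cornerPole (x : Tet × Fin 4) (c : EdgeColor) : D.Ladderpole :=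
  pole (D.front (D.exists_corner_color x c).choose)

theorem cornerPole_color_front (s : TetFlag Tet) :
    D.cornerPole s.corner (D.color (D.front s)) = pole (D.front s) := by
  obtain ⟨hcorner, hcolor⟩ := (D.exists_corner_color s.corner (D.color (D.front s))).choose_spec
  unfold cornerPole
  generalize (D.exists_corner_color s.corner (D.color (D.front s))).choose = r at *
  have pole_rot (s : TetFlag Tet) (h : D.color (D.front s) = D.color (D.front s.rot)) :
      pole (D.front s) = pole (D.front s.rot) :=
    Quot.sound ⟨s.tet, s.label, rfl, rfl, h⟩
  rcases TetFlag.eq_of_corner_eq hcorner with rfl | rfl | rfl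
  · rfl
  · exact pole_rot r hcolor
  · have := pole_rot r.rot.rot
    rw [r.rot_rot_rot] at this
    exact (this hcolor.symm).symm

theorem color_cornerPole (x : Tet × Fin 4) (c : EdgeColor) : (D.cornerPole x c).color = c :=
  (D.exists_corner_color x c).choose_spec.2

theorem vertex_cornerPole (x : Tet × Fin 4) (c : EdgeColor) :
    (D.cornerPole x c).vertex = D.vertexAt x :=
  congrArg D.vertexAt (D.exists_corner_color x c).choose_spec.1

theorem cornerPole_turn_color_front (s : TetFlag Tet) :
    D.cornerPole (D.turn s).corner (D.color (D.front s)) = pole (D.front s) := by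
  have := D.cornerPole_color_front (D.turn s)
  rwa [D.front_turn] at this

theorem cornerPole_turn_color_front_rot (s : TetFlag Tet) :
    D.cornerPole (D.turn s).corner (D.color (D.front s.rot)) = pole (D.front s.rot) := by
  have := D.cornerPole_color_front (D.turn s).rot.rot
  rwa [D.front_turn_rot_rot] at this

theorem cornerPole_turn {s : TetFlag Tet}
    (h : D.Upward s.corner ↔ D.Upward (D.turn s).corner) :
    D.cornerPole (D.turn s).corner = D.cornerPole s.corner := by
  funext c
  rcases EdgeColor.eq_or_eq_of_ne ((D.upward_turn_iff s).1 h) c with rfl | rfl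
  · exact (D.cornerPole_turn_color_front s).trans (D.cornerPole_color_front s).symm
  · exact (D.cornerPole_turn_color_front_rot s).trans (D.cornerPole_color_front s.rot).symm

variable {D}

theorem frontPi_of_upward_change_of_red {s : TetFlag Tet}
    (hc : D.color (D.front s) = EdgeColor.red)
    (h : ¬ (D.Upward s.corner ↔ D.Upward (D.turn s).corner)) : D.FrontPi s := by
  by_contra hpi
  have hout : D.OutAt s 2 ↔ ¬ D.OutAt s 3 := D.out_iff _ _ hpi
  exact h ((D.upward_corner_iff_of_red hc).trans (hout.trans ((D.outAt_two_turn s).symm.trans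
    (D.upward_corner_iff_of_red ((congrArg D.color (D.front_turn s)).trans hc)).symm)))

theorem frontPi_turn_of_upward_change_of_blue {s : TetFlag Tet}
    (hc : D.color (D.front s) = EdgeColor.blue)
    (h : ¬ (D.Upward s.corner ↔ D.Upward (D.turn s).corner)) : D.FrontPi (D.turn s) := by
  by_contra hpi
  exact h ((D.upward_corner_iff_of_blue hc).trans (((D.outAt_three_turn_iff s).2 hpi).symm.trans
    (D.upward_corner_iff_of_blue ((congrArg D.color (D.front_turn s)).trans hc)).symm))

theorem PoleStep.exists_flag {e e' : D.OEdge} (h : D.PoleStep e e') : ∃ s : TetFlag Tet,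
    D.color (D.front s) = D.color (D.front s.rot) ∧
      (e = D.front s ∧ e' = D.front s.rot ∨ e = D.front s.rot ∧ e' = D.front s) := by
  obtain ⟨t, σ, rfl, rfl, hc⟩ := h
  rcases Int.units_eq_one_or (Equiv.Perm.sign σ) with hσ | hσ
  · exact ⟨⟨t, σ, hσ⟩, hc, Or.inl ⟨rfl, rfl⟩⟩
  · exact ⟨⟨t, σ * Equiv.swap 1 2, sign_mul_swap_eq_one (by decide) hσ⟩, hc.symm,
      Or.inr ⟨rfl, rfl⟩⟩

variable [Finite Tet]

instance : Finite D.Ladderpole :=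
  inferInstanceAs (Finite (Quot D.PoleStep))

theorem eq_of_upward_change {s s' : TetFlag Tet} (hfront : D.front s = D.front s')
    (hup : D.Upward s.corner ↔ D.Upward s'.corner)
    (hs : ¬ (D.Upward s.corner ↔ D.Upward (D.turn s).corner))
    (hs' : ¬ (D.Upward s'.corner ↔ D.Upward (D.turn s').corner)) : s = s' := by
  cases hc : D.color (D.front s)
  · have hpi := frontPi_of_upward_change_of_red hc hs
    have hpi' := frontPi_of_upward_change_of_red (hfront ▸ hc) hs'
    exact (D.existsUnique_frontPi (D.front s) (D.Upward s.corner)).unique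
      ⟨rfl, hpi, hpi.outAt_iff.2.2⟩ ⟨hfront.symm, hpi', hpi'.outAt_iff.2.2.trans hup.symm⟩
  · have hpi := frontPi_turn_of_upward_change_of_blue hc hs
    have hpi' := frontPi_turn_of_upward_change_of_blue (hfront ▸ hc) hs'
    have hup' : D.Upward (D.turn s').corner ↔ D.Upward (D.turn s).corner := by tauto
    exact D.turn.injective <|
      (D.existsUnique_frontPi (D.front s) (D.Upward (D.turn s).corner)).unique
        ⟨D.front_turn s, hpi, hpi.outAt_iff.2.2⟩
        ⟨(D.front_turn s').trans hfront.symm, hpi', hpi'.outAt_iff.2.2.trans hup'⟩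

theorem cornerPole_eq_of_front_eq {s s' : TetFlag Tet} (hfront : D.front s = D.front s')
    (hup : D.Upward s.corner ↔ D.Upward s'.corner) :
    D.cornerPole s.corner = D.cornerPole s'.corner :=
  apply_eq_of_sameCycle_of_subsingleton_change (u := fun s => D.cornerPole s.corner)
    (p := fun s => D.Upward s.corner) (fun _ h => D.cornerPole_turn h)
    (fun _ _ h => eq_of_upward_change (D.sameCycle_turn_iff.1 h))
    (D.sameCycle_turn_iff.2 hfront) hup

/-- The pair of ladderpole curves through the triangles at the vertex `e` of the boundary
triangulation that point upwards (if `p`) or downwards (if `¬ p`), indexed by their colours. All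
these triangles lie on the same side of the ladderpole curve through `e`. -/
noncomputable def besideEdge (e : D.OEdge) (p : Prop) : EdgeColor → D.Ladderpole :=
  D.cornerPole (D.exists_front_upward e p).choose.corner

theorem besideEdge_front (s : TetFlag Tet) :
    besideEdge (D.front s) (D.Upward s.corner) = D.cornerPole s.corner := by
  obtain ⟨hfront, hup⟩ := (D.exists_front_upward (D.front s) (D.Upward s.corner)).choose_spec
  exact cornerPole_eq_of_front_eq hfront hup

theorem besideEdge_front_rot {s : TetFlag Tet} (h : D.color (D.front s) = D.color (D.front s.rot))
    (p : Prop) : besideEdge (D.front s) p = besideEdge (D.front s.rot) p := by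
  have hup : ¬ (D.Upward s.corner ↔ D.Upward (D.turn s).corner) :=
    fun hup => (D.upward_turn_iff s).1 hup h
  by_cases hp : p ↔ D.Upward s.corner
  · rw [propext hp]
    exact (besideEdge_front s).trans (besideEdge_front s.rot).symm
  · have hp' : p ↔ D.Upward (D.turn s).corner := by tauto
    rw [propext hp', ← D.front_turn, ← D.front_turn_rot_rot]
    exact (besideEdge_front (D.turn s)).trans (besideEdge_front (D.turn s).rot.rot).symm

/-- The pair of ladderpole curves through the triangles at `l` that point upwards (if `p`) or
downwards (if `¬ p`), indexed by their colours: one of them is `l`, the other one is a neighbour. -/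
noncomputable def Ladderpole.beside : D.Ladderpole → Prop → EdgeColor → D.Ladderpole :=
  Quot.lift besideEdge fun e e' h => by
    funext p
    obtain ⟨s, hc, ⟨rfl, rfl⟩ | ⟨rfl, rfl⟩⟩ := PoleStep.exists_flag h
    · exact besideEdge_front_rot hc p
    · exact (besideEdge_front_rot hc p).symm

theorem Ladderpole.beside_cornerPole (x : Tet × Fin 4) (c : EdgeColor) :
    (D.cornerPole x c).beside (D.Upward x) = D.cornerPole x := by
  obtain ⟨s, rfl, rfl⟩ := D.exists_corner_color x c
  rw [D.cornerPole_color_front]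
  exact besideEdge_front s

theorem Ladderpole.exists_eq_cornerPole (l : D.Ladderpole) (p : EdgeColor → Prop) :
    ∃ x c, (D.Upward x ↔ p c) ∧ l = D.cornerPole x c := by
  obtain ⟨e, rfl⟩ := Quot.mk_surjective l
  obtain ⟨s, rfl, hs⟩ := D.exists_front_upward e (p (D.color e))
  exact ⟨s.corner, _, hs, (D.cornerPole_color_front s).symm⟩

/-- The ladderpole curve next on the left. Its triangles beside a red curve point upwards, those
beside a blue curve point downwards. -/
noncomputable def leftPole : Equiv.Perm D.Ladderpole where
  toFun l := l.beside (l.color = EdgeColor.red) l.color.other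
  invFun l := l.beside (l.color = EdgeColor.blue) l.color.other
  left_inv l := by
    obtain ⟨x, c, hx, rfl⟩ := l.exists_eq_cornerPole (· = EdgeColor.red)
    have hx' : D.Upward x = (c.other = EdgeColor.blue) := by
      cases c <;> simp_all [EdgeColor.other]
    simp only [color_cornerPole, ← propext hx, Ladderpole.beside_cornerPole]
    rw [← hx', Ladderpole.beside_cornerPole, c.other_other]
  right_inv l := by
    obtain ⟨x, c, hx, rfl⟩ := l.exists_eq_cornerPole (· = EdgeColor.blue)
    have hx' : D.Upward x = (c.other = EdgeColor.red) := by
      cases c <;> simp_all [EdgeColor.other]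
    simp only [color_cornerPole, ← propext hx, Ladderpole.beside_cornerPole]
    rw [← hx', Ladderpole.beside_cornerPole, c.other_other]

theorem leftPole_cornerPole {x : Tet × Fin 4} {c : EdgeColor}
    (h : D.Upward x ↔ c = EdgeColor.red) :
    leftPole (D.cornerPole x c) = D.cornerPole x c.other := by
  change (D.cornerPole x c).beside ((D.cornerPole x c).color = EdgeColor.red)
    (D.cornerPole x c).color.other = _
  rw [color_cornerPole, ← propext h, Ladderpole.beside_cornerPole]

theorem color_leftPole (l : D.Ladderpole) : (leftPole l).color = l.color.other := by
  obtain ⟨x, c, hx, rfl⟩ := l.exists_eq_cornerPole (· = EdgeColor.red)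
  rw [leftPole_cornerPole hx, color_cornerPole, color_cornerPole]

theorem vertex_leftPole (l : D.Ladderpole) : (leftPole l).vertex = l.vertex := by
  obtain ⟨x, c, hx, rfl⟩ := l.exists_eq_cornerPole (· = EdgeColor.red)
  rw [leftPole_cornerPole hx, vertex_cornerPole, vertex_cornerPole]

theorem leftPole_pole_front_rot {s : TetFlag Tet} (hout : D.OutAt s 3)
    (hne : D.color (D.front s) ≠ D.color (D.front s.rot)) :
    leftPole (pole (D.front s.rot)) = pole (D.front s) := by
  have := leftPole_cornerPole (D.upward_corner_iff_of_rung hout hne)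
  rw [← EdgeColor.ne_iff_eq_other.1 hne, D.cornerPole_color_front] at this
  rw [← D.cornerPole_color_front s.rot]
  exact this

theorem nextLeft_iff {l l' : D.Ladderpole} : NextLeft l l' ↔ l = leftPole l' := by
  constructor
  · rintro ⟨_, _, rfl, rfl, t, σ, hσ, hout, rfl, rfl, hne⟩
    exact (leftPole_pole_front_rot (s := ⟨t, σ, hσ⟩) hout hne).symm
  · rintro rfl
    obtain ⟨x, c, hx, rfl⟩ := l'.exists_eq_cornerPole (· = EdgeColor.red)
    obtain ⟨s, rfl, hout, hne⟩ := D.exists_rung x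
    have hc : D.color (D.front s.rot) = c := by
      have := (D.upward_corner_iff_of_rung hout hne).symm.trans hx
      cases hc : D.color (D.front s.rot) <;> cases c <;> simp_all
    have hpole : D.cornerPole s.corner c = pole (D.front s.rot) :=
      hc ▸ D.cornerPole_color_front s.rot
    rw [hpole, leftPole_pole_front_rot hout hne]
    exact ⟨_, _, rfl, rfl, s.tet, s.label, s.sign_label, hout, rfl, rfl, hne⟩

theorem twoLeft_iff {l l' : D.Ladderpole} : TwoLeft l l' ↔ l = leftPole (leftPole l') := by
  simp only [TwoLeft, nextLeft_iff, exists_eq_right]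

theorem sameCycle_cornerPole (x : Tet × Fin 4) (c c' : EdgeColor) :
    leftPole.SameCycle (D.cornerPole x c) (D.cornerPole x c') := by
  have other (c) (h : D.Upward x ↔ c = EdgeColor.red) :
      leftPole.SameCycle (D.cornerPole x c) (D.cornerPole x c.other) := by
    rw [← leftPole_cornerPole h]
    exact Equiv.Perm.sameCycle_apply_right.2 (.refl _ _)
  by_cases h : D.Upward x
  · have := other EdgeColor.red (by simp [h])
    cases c <;> cases c' <;> first | exact .refl _ _ | exact this | exact this.symm
  · have := other EdgeColor.blue (by simp [h])
    cases c <;> cases c' <;> first | exact .refl _ _ | exact this | exact this.symm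

theorem sameCycle_leftPole_iff {l l' : D.Ladderpole} :
    leftPole.SameCycle l l' ↔ l.vertex = l'.vertex := by
  constructor
  · exact fun h => prop_of_sameCycle (p := fun m => l.vertex = m.vertex)
      (fun m hm => hm.trans (vertex_leftPole m).symm) h rfl
  intro h
  have step (x y) (hxy : D.VertexGlued x y) :
      leftPole.SameCycle (D.cornerPole x EdgeColor.red) (D.cornerPole y EdgeColor.red) := by
    obtain ⟨s, rfl, rfl⟩ := D.vertexGlued_iff_exists_turn.1 hxy
    have hs := sameCycle_cornerPole (D := D) s.corner EdgeColor.red (D.color (D.front s))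
    rw [D.cornerPole_color_front, ← D.cornerPole_turn_color_front] at hs
    exact hs.trans (sameCycle_cornerPole _ _ _)
  obtain ⟨x, c, -, rfl⟩ := l.exists_eq_cornerPole (· = EdgeColor.red)
  obtain ⟨y, c', -, rfl⟩ := l'.exists_eq_cornerPole (· = EdgeColor.red)
  rw [vertex_cornerPole, vertex_cornerPole] at h
  have := ((Equiv.Perm.SameCycle.equivalence leftPole).comap
    (D.cornerPole · EdgeColor.red)).eqvGen_iff.1 ((Quot.eqvGen_exact h).mono step)
  exact (sameCycle_cornerPole _ _ _).trans (this.trans (sameCycle_cornerPole _ _ _))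

end VeeringTriangulation

/-! ### Red edges -/

namespace IdealTriangulation

variable {Tet : Type*} (D : IdealTriangulation Tet)

theorem vertexAt_glue (t : Tet) {f i : Fin 4} (h : i ≠ f) :
    D.vertexAt (D.glueTet t f, D.glueMap t f i) = D.vertexAt (t, i) :=
  (Quot.sound ⟨f, h.symm, rfl⟩ : D.vertexAt (t, i) = _).symm

theorem rev_rev (e : D.OrientedEdge) : e.rev.rev = e := by
  obtain ⟨e, rfl⟩ := Quot.mk_surjective e
  rfl

end IdealTriangulation

namespace VeeringTriangulation

variable {Tet : Type*} (D : VeeringTriangulation Tet)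

/-- Two vertices are joined by a path of red edges. -/
def RedJoined : D.Vert → D.Vert → Prop :=
  Relation.EqvGen fun T T' =>
    ∃ e : D.OEdge, D.color e = EdgeColor.red ∧ e.source = T ∧ e.target = T'

theorem redJoined_equivalence : Equivalence D.RedJoined :=
  Relation.EqvGen.is_equivalence _

theorem redJoined_source_target {e : D.OEdge} (he : D.color e = EdgeColor.red) :
    D.RedJoined e.source e.target :=
  .rel _ _ ⟨e, he, rfl, rfl⟩

/-- The corners of a tetrahedron lie at vertices that are joined by paths of red edges. -/
def TetRedJoined (t : Tet) : Prop := ∀ i j, D.RedJoined (D.vertexAt (t, i)) (D.vertexAt (t, j))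

theorem exists_redJoined_ne (t : Tet) (i : Fin 4) :
    ∃ j ≠ i, D.RedJoined (D.vertexAt (t, i)) (D.vertexAt (t, j)) := by
  obtain ⟨s, hs, hpi⟩ := D.exists_frontPi_corner (t, i)
  obtain ⟨rfl, rfl⟩ := Prod.mk.inj hs
  exact ⟨s.label 2, s.label.injective.ne (by decide),
    D.redJoined_source_target (D.color_of_frontPi hpi).1⟩

variable {D}

theorem tetRedJoined_of_face {t : Tet} {f : Fin 4}
    (h : ∀ i ≠ f, ∀ j ≠ f, D.RedJoined (D.vertexAt (t, i)) (D.vertexAt (t, j))) :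
    D.TetRedJoined t := by
  have exists_ne (i) : ∃ i' ≠ f, D.RedJoined (D.vertexAt (t, i)) (D.vertexAt (t, i')) := by
    by_cases hi : i = f
    · exact hi ▸ D.exists_redJoined_ne t i
    · exact ⟨i, hi, D.redJoined_equivalence.refl _⟩
  intro i j
  obtain ⟨i', hi', hii'⟩ := exists_ne i
  obtain ⟨j', hj', hjj'⟩ := exists_ne j
  exact D.redJoined_equivalence.trans hii'
    (D.redJoined_equivalence.trans (h i' hi' j' hj') (D.redJoined_equivalence.symm hjj'))

theorem tetRedJoined_glue_iff {t : Tet} {f : Fin 4} :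
    D.TetRedJoined t ↔ D.TetRedJoined (D.glueTet t f) := by
  constructor <;> intro h
  · refine tetRedJoined_of_face (f := D.glueMap t f f) fun i hi j hj => ?_
    obtain ⟨i, rfl⟩ := (D.glueMap t f).surjective i
    obtain ⟨j, rfl⟩ := (D.glueMap t f).surjective j
    rw [D.vertexAt_glue t (ne_of_apply_ne _ hi), D.vertexAt_glue t (ne_of_apply_ne _ hj)]
    exact h i j
  · refine tetRedJoined_of_face (f := f) fun i hi j hj => ?_
    rw [← D.vertexAt_glue t hi, ← D.vertexAt_glue t hj]
    exact h _ _

theorem tetRedJoined_of_frontPi {s : TetFlag Tet} (hpi : D.FrontPi s)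
    (hred : D.color (D.front s) = EdgeColor.red) : D.TetRedJoined s.tet := by
  have h01 : D.RedJoined (D.vertexAt (s.tet, s.label 0)) (D.vertexAt (s.tet, s.label 1)) :=
    D.redJoined_source_target hred
  have h02 : D.RedJoined (D.vertexAt (s.tet, s.label 0)) (D.vertexAt (s.tet, s.label 2)) :=
    D.redJoined_source_target (D.color_of_frontPi hpi).1
  have h13 : D.RedJoined (D.vertexAt (s.tet, s.label 1)) (D.vertexAt (s.tet, s.label 3)) :=
    D.redJoined_source_target (D.veering s.tet s.label s.sign_label hpi).2.2.1
  have joined_zero (i) :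
      D.RedJoined (D.vertexAt (s.tet, s.label 0)) (D.vertexAt (s.tet, s.label i)) := by
    fin_cases i
    exacts [D.redJoined_equivalence.refl _, h01, h02, D.redJoined_equivalence.trans h01 h13]
  intro i j
  obtain ⟨i, rfl⟩ := s.label.surjective i
  obtain ⟨j, rfl⟩ := s.label.surjective j
  exact D.redJoined_equivalence.trans (D.redJoined_equivalence.symm (joined_zero i)) (joined_zero j)

variable [Finite Tet]

theorem tetRedJoined (hD : D.Connected) (t : Tet) : D.TetRedJoined t := by
  obtain ⟨r, -, hr⟩ := D.exists_corner_color (t, 0) EdgeColor.red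
  obtain ⟨s, ⟨hs, hpi, -⟩, -⟩ := D.existsUnique_frontPi (D.front r) True
  have iff_equivalence : Equivalence Iff := ⟨Iff.refl, Iff.symm, Iff.trans⟩
  have step (u u' : Tet) (hu : ∃ f, u' = D.glueTet u f) : D.TetRedJoined u ↔ D.TetRedJoined u' := by
    obtain ⟨f, rfl⟩ := hu
    exact tetRedJoined_glue_iff
  exact ((iff_equivalence.comap D.TetRedJoined).eqvGen_iff.1 ((hD s.tet t).mono step)).1
    (tetRedJoined_of_frontPi hpi (hs ▸ hr))

theorem redJoined (hD : D.Connected) (T T' : D.Vert) : D.RedJoined T T' := by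
  obtain ⟨⟨t, i⟩, rfl⟩ := Quot.mk_surjective T
  obtain ⟨⟨t', i'⟩, rfl⟩ := Quot.mk_surjective T'
  have step (u u' : Tet) (hu : ∃ f, u' = D.glueTet u f) :
      D.RedJoined (D.vertexAt (u, 0)) (D.vertexAt (u', 0)) := by
    obtain ⟨f, rfl⟩ := hu
    obtain ⟨j, hj⟩ := exists_ne f
    refine D.redJoined_equivalence.trans (tetRedJoined hD u 0 j) ?_
    rw [← D.vertexAt_glue u hj]
    exact tetRedJoined hD _ _ _
  have joined_zero := (D.redJoined_equivalence.comap fun u => D.vertexAt (u, 0)).eqvGen_iff.1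
    ((hD t t').mono step)
  exact D.redJoined_equivalence.trans (tetRedJoined hD t i 0)
    (D.redJoined_equivalence.trans joined_zero (tetRedJoined hD t' 0 i'))

end VeeringTriangulation

namespace TransverseTautTriangulation

variable {Tet : Type*} (D : TransverseTautTriangulation Tet)

theorem exists_upward (t : Tet) : ∃ a, D.Upward (t, a) := by
  obtain ⟨s, hs, hpi⟩ := D.exists_frontPi_corner (t, 0)
  obtain rfl : s.tet = t := congrArg Prod.fst hs
  by_cases hup : D.Upward s.corner
  · exact ⟨s.label 0, hup⟩
  · exact ⟨s.label 2, fun hout => hup (hpi.outAt_iff.2.1.1 hout)⟩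

variable {D}

theorem FrontPi.front_eq_or_rev_eq {s s' : TetFlag Tet} (hpi : D.FrontPi s) (hpi' : D.FrontPi s')
    (htet : s'.tet = s.tet) (hup : D.Upward s.corner) (hup' : D.Upward s'.corner) :
    D.front s = D.front s' ∨ (D.front s).rev = D.front s' := by
  have hout := hpi.outAt_iff
  have hpi_s : D.IsPi s.tet (s'.label 0) (s'.label 1) := htet ▸ hpi'
  have hup_s : ¬ D.Out s.tet (s'.label 0) := htet ▸ hup'
  rcases (D.isPi_iff_of_isPi hpi _ _).1 hpi_s with h | h <;>
    rcases Sym2.eq_iff.1 h with ⟨h0, h1⟩ | ⟨h0, h1⟩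
  · exact Or.inl (congrArg (Quot.mk _) (TetEdge.ext htet.symm h0.symm h1.symm))
  · exact Or.inr (congrArg (Quot.mk _) (TetEdge.ext htet.symm h0.symm h1.symm))
  · rw [h0] at hup_s
    exact absurd (hout.2.1.2 hup) hup_s
  · rw [h0] at hup_s
    exact absurd (hout.2.2.2 hup) hup_s

variable [Finite Tet]

variable (D) in
theorem exists_bottom_edge : ∃ b : Tet → D.OrientedEdge, ∀ e, ∃ t, b t = e ∨ (b t).rev = e := by
  have exists_bottom (t : Tet) :
      ∃ s : TetFlag Tet, s.tet = t ∧ D.FrontPi s ∧ D.Upward s.corner := by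
    obtain ⟨a, ha⟩ := D.exists_upward t
    obtain ⟨s, hs, hpi⟩ := D.exists_frontPi_corner (t, a)
    exact ⟨s, congrArg Prod.fst hs, hpi, hs ▸ ha⟩
  choose b hbtet hbpi hbup using exists_bottom
  refine ⟨fun t => D.front (b t), fun e => ?_⟩
  obtain ⟨s, ⟨rfl, hpi, hout⟩, -⟩ := D.existsUnique_frontPi e True
  exact ⟨s.tet, (hbpi s.tet).front_eq_or_rev_eq hpi (hbtet s.tet).symm (hbup s.tet)
    (hpi.outAt_iff.2.2.1 (hout.2 trivial))⟩

end TransverseTautTriangulation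

namespace VeeringTriangulation

variable {Tet : Type*} {D : VeeringTriangulation Tet}

variable (D) in
/-- The red oriented edges. -/
abbrev RedEdge : Type _ := {e : D.OEdge // D.color e = EdgeColor.red}

/-- The red edge with the opposite orientation. -/
def RedEdge.reverse (e : D.RedEdge) : D.RedEdge := ⟨e.1.rev, (D.color_rev e.1).trans e.2⟩

theorem RedEdge.reverse_reverse (e : D.RedEdge) : e.reverse.reverse = e :=
  Subtype.ext (D.rev_rev e.1)

/-- The red edges `d' j`, followed by their reverses. -/
def withReverses {ι : Type*} (d' : ι → D.RedEdge) : ι ⊕ ι → D.RedEdge :=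
  Sum.elim d' fun j => (d' j).reverse

variable (D) in
/-- The red ladderpole curves. -/
abbrev RedPole : Type _ := {l : D.Ladderpole // l.color = EdgeColor.red}

/-- The red ladderpole curve of the initial end of a red edge. -/
def RedEdge.departure (e : D.RedEdge) : D.RedPole := ⟨pole e.1, e.2⟩

/-- The red ladderpole curve of the terminal end of a red edge. -/
def RedEdge.arrival (e : D.RedEdge) : D.RedPole := e.reverse.departure

theorem RedEdge.arrival_reverse (e : D.RedEdge) : e.reverse.arrival = e.departure :=
  congrArg departure e.reverse_reverse

theorem RedEdge.arrival_surjective : Function.Surjective (arrival : D.RedEdge → D.RedPole) := by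
  rintro ⟨l, hl⟩
  obtain ⟨e, rfl⟩ := Quot.mk_surjective l
  exact ⟨RedEdge.reverse ⟨e, hl⟩, RedEdge.arrival_reverse ⟨e, hl⟩⟩

theorem exists_redPole (T : D.Vert) : ∃ r : D.RedPole, r.1.vertex = T := by
  obtain ⟨x, rfl⟩ := Quot.mk_surjective T
  exact ⟨⟨D.cornerPole x EdgeColor.red, D.color_cornerPole x _⟩, D.vertex_cornerPole x _⟩

theorem RedEdgeSequence.arranges_of_equiv {M k P : ℕ} {S : D.RedEdgeSequence P}
    {d : Fin M → D.RedEdge} {d' : Fin k → D.RedEdge} (φ : Fin P ≃ Fin M ⊕ (Fin k ⊕ Fin k))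
    (hφ : ∀ i, S.edge i = Sum.elim d (withReverses d') (φ i)) :
    S.Arranges (fun i => (d i).1) (fun j => (d' j).1) := by
  have hS : S.edge = (fun a => (Sum.elim d (withReverses d') a).1) ∘ φ := funext hφ
  rw [Arranges, ← Multiset.coe_eq_coe]
  simp only [← Multiset.coe_add, ← Fin.univ_val_map]
  rw [hS, ← Multiset.map_map, Multiset.map_univ_val_equiv, ← Finset.univ_disjSum_univ,
    ← Finset.univ_disjSum_univ]
  simp [Finset.disjSum, Multiset.disjSum, withReverses, RedEdge.reverse, Function.comp_def]

variable [Finite Tet]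

variable (D) in
theorem exists_withReverses_surjective : ∃ (R : Set Tet) (b : R → D.RedEdge),
    Function.Surjective (withReverses b) := by
  obtain ⟨b, hb⟩ := D.exists_bottom_edge
  refine ⟨{t | D.color (b t) = EdgeColor.red}, fun t => ⟨b t, t.2⟩, ?_⟩
  rintro ⟨e, he⟩
  obtain ⟨t, rfl | rfl⟩ := hb e
  · exact ⟨Sum.inl ⟨t, he⟩, rfl⟩
  · exact ⟨Sum.inr ⟨t, (D.color_rev _).symm.trans he⟩, rfl⟩

variable (D) in
theorem exists_red_family (c : ℕ) : ∃ k ≤ c * Nat.card Tet, ∃ d' : Fin k → D.RedEdge,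
    ∀ e, c ≤ Nat.card {a // withReverses d' a = e} := by
  obtain ⟨R, b, hb⟩ := D.exists_withReverses_surjective
  let φ := (Finite.equivFin (Fin c × R)).symm
  refine ⟨Nat.card (Fin c × R), ?_, fun j => b (φ j).2, fun e => ?_⟩
  · rw [Nat.card_prod, Nat.card_fin]
    exact Nat.mul_le_mul_left c (Finite.card_subtype_le _)
  · obtain ⟨a, rfl⟩ := hb e
    let copy (i : Fin c) : {x // withReverses (fun j => b (φ j).2) x = withReverses b a} :=
      ⟨a.map (fun t => φ.symm (i, t)) (fun t => φ.symm (i, t)), by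
        cases a <;> simp [withReverses]⟩
    have copy_injective : Function.Injective copy := fun i i' h => by
      have := congrArg Subtype.val h
      cases a <;> simp_all [copy]
    simpa using Nat.card_le_card_of_injective copy copy_injective

/-! ### Red edge sequences -/

theorem color_leftPole_eq_blue_iff {l : D.Ladderpole} :
    (leftPole l).color = EdgeColor.blue ↔ l.color = EdgeColor.red := by
  rw [color_leftPole]
  cases l.color <;> simp [EdgeColor.other]

theorem color_leftPole_pow_eq_iff (n : ℕ) {l : D.Ladderpole} :
    ((leftPole ^ n) l).color = l.color ↔ Even n := by
  induction n with
  | zero => simp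
  | succ n ih =>
    rw [pow_succ', Equiv.Perm.mul_apply, color_leftPole, Nat.even_add_one, ← ih, eq_comm,
      ← EdgeColor.ne_iff_eq_other, ne_comm]

/-- The red ladderpole curve two to the left of a red one. -/
noncomputable def leftRed : Equiv.Perm D.RedPole :=
  (leftPole ^ 2).subtypePerm fun l => by
    rw [(color_leftPole_pow_eq_iff 2).2 even_two]

theorem sameCycle_leftRed_iff {r r' : D.RedPole} :
    leftRed.SameCycle r r' ↔ r.1.vertex = r'.1.vertex := by
  rw [leftRed, Equiv.Perm.sameCycle_subtypePerm, ← sameCycle_leftPole_iff]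
  refine ⟨Equiv.Perm.SameCycle.of_pow, fun h => ?_⟩
  obtain ⟨n, hn⟩ := h.exists_nat_pow_eq
  obtain ⟨m, rfl⟩ := ((color_leftPole_pow_eq_iff n).1 (hn ▸ r'.2.trans r.2.symm)).two_dvd
  exact ⟨m, by rw [zpow_natCast, ← pow_mul, hn]⟩

theorem ladderpoleMultiplicity_eq (T : D.Vert) :
    D.ladderpoleMultiplicity T = Nat.card {r : D.RedPole // r.1.vertex = T} := by
  have card_red : Nat.card {r : D.RedPole // r.1.vertex = T} =
      Nat.card {l : D.Ladderpole // l.color = EdgeColor.red ∧ l.vertex = T} :=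
    Nat.card_congr (Equiv.subtypeSubtypeEquivSubtypeInter _ fun l : D.Ladderpole => l.vertex = T)
  have card_blue : Nat.card {l : D.Ladderpole // l.color = EdgeColor.red ∧ l.vertex = T} =
      Nat.card {l : D.Ladderpole // l.color = EdgeColor.blue ∧ l.vertex = T} :=
    Nat.card_congr (leftPole.subtypeEquiv fun l => by
      rw [color_leftPole_eq_blue_iff, vertex_leftPole])
  have card_all : Nat.card {l : D.Ladderpole // l.vertex = T} =
      Nat.card {l : D.Ladderpole // l.color = EdgeColor.red ∧ l.vertex = T} +
        Nat.card {l : D.Ladderpole // l.color = EdgeColor.blue ∧ l.vertex = T} := by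
    rw [← card_subtype_or_of_disjoint (by simp +contextual)]
    refine Nat.card_congr (Equiv.subtypeEquivRight fun l => ?_)
    cases l.color <;> simp
  rw [ladderpoleMultiplicity]
  omega

theorem two_le_maxLadderpoleMultiplicity {r r' : D.RedPole} (hne : r ≠ r')
    (h : r.1.vertex = r'.1.vertex) : 2 ≤ D.maxLadderpoleMultiplicity := by
  have two_le : 2 ≤ D.ladderpoleMultiplicity r'.1.vertex := by
    rw [ladderpoleMultiplicity_eq]
    exact Finite.one_lt_card_iff_nontrivial.2
      ⟨⟨r, h⟩, ⟨r', rfl⟩, fun hrr' => hne (congrArg Subtype.val hrr')⟩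
  exact two_le.trans (le_ciSup (Set.finite_range D.ladderpoleMultiplicity).bddAbove _)

theorem exists_crossing_numbers {M : ℕ} {d : Fin M → D.RedEdge}
    (hd : ∀ T, Nat.card {i // (d i).arrival.1.vertex = T} =
      Nat.card {i // (d i).departure.1.vertex = T}) (α : D.Vert → ℕ) :
    ∃ x : D.RedPole → ℕ,
      (∀ r, x r ≤ α r.1.vertex + D.maxLadderpoleMultiplicity * M / 2) ∧
      (∀ T, IsLeast (x '' {r | r.1.vertex = T}) (α T)) ∧
      ∀ r, Nat.card {i // (d i).arrival = leftRed r} + x r =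
        Nat.card {i // (d i).departure = leftRed r} + x (leftRed r) := by
  obtain ⟨x, hle, hleast, hbal⟩ := exists_flow_isLeast
    (v := fun r : D.RedPole => r.1.vertex) (fun _ _ => sameCycle_leftRed_iff) hd α
  refine ⟨x, fun r => ?_, fun T => ?_, hbal⟩
  · by_cases hν : 2 ≤ D.maxLadderpoleMultiplicity
    · have := Nat.mul_le_mul_right M hν
      have := hle r
      rw [Nat.card_fin] at this
      omega
    · obtain ⟨r', hr', hx⟩ := (hleast r).1
      obtain rfl : r' = r := by
        by_contra hne
        exact hν (two_le_maxLadderpoleMultiplicity hne hr')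
      exact hx.le.trans (Nat.le_add_right _ _)
  · obtain ⟨r, rfl⟩ := exists_redPole T
    exact hleast r

theorem vertex_leftRed (r : D.RedPole) : (leftRed r).1.vertex = r.1.vertex :=
  (sameCycle_leftRed_iff.1 (Equiv.Perm.sameCycle_apply_right.2 (.refl _ r))).symm

theorem exists_redEdgeSequence_of_isArrangement {E : Type*} [Finite E] {P : ℕ}
    (hP : Nat.card E = P) {G : E → D.RedEdge} {x : D.RedPole → ℕ} {s : Equiv.Perm E}
    {c : E → Prop}
    (h : IsArrangement (fun e => (G e).arrival) (fun e => (G e).departure) leftRed x s c)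
    (hs : ∀ a b, s.SameCycle a b) (hc : ∃ e, ¬ c e) :
    ∃ (S : D.RedEdgeSequence P) (φ : Fin P ≃ E), (∀ i, S.edge i = G (φ i)) ∧
      ∀ r : D.RedPole, S.crossings (leftPole r) = x r := by
  obtain ⟨φ, hφ⟩ := exists_equiv_finRotate hP hs
  obtain ⟨e, he⟩ := hc
  refine ⟨
    { edge i := G (φ i)
      vert i := (G (φ i)).1.target
      cross i := c (φ i)
      color_edge i := (G (φ i)).2
      target_edge _ := rfl
      source_edge i := ?_
      same_of_not_cross i hi := ?_
      left_of_cross i hi := ?_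
      exists_not_cross := ⟨φ.symm e, by rwa [φ.apply_symm_apply]⟩ }, φ, fun _ => rfl, fun r => ?_⟩
  · rw [hφ]
    change (G (s (φ i))).departure.1.vertex = (G (φ i)).arrival.1.vertex
    by_cases hi : c (φ i)
    · rw [h.out_of_cross _ hi, vertex_leftRed]
    · rw [h.out_of_not_cross _ hi]
  · rw [hφ]
    exact congrArg Subtype.val (h.out_of_not_cross _ hi)
  · rw [hφ, twoLeft_iff]
    exact congrArg Subtype.val (h.out_of_cross _ hi)
  · rw [← h.card_cross r]
    refine Nat.card_congr (φ.subtypeEquiv fun i => ?_)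
    rw [nextLeft_iff, leftPole.injective.eq_iff, and_comm, eq_comm, Subtype.ext_iff]
    rfl

theorem RedEdgeSequence.isLeast_crossings_iff {P : ℕ} {S : D.RedEdgeSequence P}
    {x : D.RedPole → ℕ} (hx : ∀ r : D.RedPole, S.crossings (leftPole r) = x r) {T : D.Vert}
    {a : ℕ} :
    IsLeast {m : ℕ | ∃ l : D.Ladderpole,
      l.vertex = T ∧ l.color = EdgeColor.blue ∧ m = S.crossings l} a ↔
    IsLeast (x '' {r | r.1.vertex = T}) a := by
  suffices h : {m : ℕ | ∃ l : D.Ladderpole,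
      l.vertex = T ∧ l.color = EdgeColor.blue ∧ m = S.crossings l} =
      x '' {r | r.1.vertex = T} by rw [h]
  ext m
  constructor
  · rintro ⟨l, rfl, hl, rfl⟩
    obtain ⟨l, rfl⟩ := leftPole.surjective l
    exact ⟨⟨l, color_leftPole_eq_blue_iff.1 hl⟩, (vertex_leftPole l).symm, (hx _).symm⟩
  · rintro ⟨r, rfl, rfl⟩
    exact ⟨leftPole r, vertex_leftPole r.1, color_leftPole_eq_blue_iff.2 r.2, (hx r).symm⟩

theorem eqvGen_linked (hD : D.Connected) {E : Type*} {G : E → D.RedEdge}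
    (hG : Function.Surjective G) (r r' : D.RedPole) :
    Relation.EqvGen (Linked (fun e => (G e).arrival) (fun e => (G e).departure) leftRed) r r' := by
  have linked_equivalence := Relation.EqvGen.is_equivalence
    (Linked (fun e => (G e).arrival) (fun e => (G e).departure) leftRed)
  have of_vertex_eq {a b : D.RedPole} (hab : a.1.vertex = b.1.vertex) : Relation.EqvGen
      (Linked (fun e => (G e).arrival) (fun e => (G e).departure) leftRed) a b :=
    prop_of_sameCycle (fun c hc => linked_equivalence.trans hc (.rel _ _ (Or.inl rfl)))
      (sameCycle_leftRed_iff.2 hab) (linked_equivalence.refl a)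
  choose base hbase using exists_redPole (D := D)
  have joined_base := (linked_equivalence.comap base).eqvGen_iff.1
    ((redJoined hD r.1.vertex r'.1.vertex).mono (by
      rintro _ _ ⟨e, he, rfl, rfl⟩
      obtain ⟨a, ha⟩ := hG ⟨e, he⟩
      have hdep : (G a).departure.1.vertex = e.source := by rw [ha]; rfl
      have harr : (G a).arrival.1.vertex = e.target := by rw [ha]; rfl
      exact linked_equivalence.trans (of_vertex_eq ((hbase _).trans hdep.symm))
        (linked_equivalence.trans (.rel _ _ (Or.inr ⟨a, rfl, rfl⟩))
          (of_vertex_eq (harr.trans (hbase _).symm)))))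
  exact linked_equivalence.trans (of_vertex_eq (hbase _).symm)
    (linked_equivalence.trans joined_base (of_vertex_eq (hbase _)))

theorem exists_redEdgeSequence [Nonempty Tet] (hD : D.Connected) {M k : ℕ} {d : Fin M → D.RedEdge}
    {d' : Fin k → D.RedEdge} {x : D.RedPole → ℕ}
    (hbal : ∀ r, Nat.card {i // (d i).arrival = leftRed r} + x r =
      Nat.card {i // (d i).departure = leftRed r} + x (leftRed r))
    (hpos : ∀ r, 0 < x r)
    (hmany : ∀ (e : D.RedEdge) r, x r < Nat.card {a // withReverses d' a = e}) :
    ∃ S : D.RedEdgeSequence (M + 2 * k),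
      S.Arranges (fun i => (d i).1) (fun j => (d' j).1) ∧
        ∀ r : D.RedPole, S.crossings (leftPole r) = x r := by
  let G := Sum.elim d (withReverses d')
  have arrival_withReverses (r) : Nat.card {a // (withReverses d' a).arrival = r} =
      Nat.card {a // (withReverses d' a).departure = r} :=
    Nat.card_congr ((Equiv.sumComm _ _).subtypeEquiv fun a => by
      cases a <;> simp [withReverses, RedEdge.arrival, RedEdge.reverse_reverse])
  have hbalG (r) : Nat.card {a // (G a).arrival = leftRed r} + x r =
      Nat.card {a // (G a).departure = leftRed r} + x (leftRed r) := by
    have := hbal r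
    have := arrival_withReverses (leftRed r)
    rw [card_subtype_sum (fun a => (G a).arrival = _),
      card_subtype_sum (fun a => (G a).departure = _)]
    simp only [G, Sum.elim_inl, Sum.elim_inr]
    omega
  have hlt (r) : x r < Nat.card {a // (G a).arrival = r} := by
    obtain ⟨e, rfl⟩ := RedEdge.arrival_surjective r
    refine (hmany e _).trans_le (Nat.card_le_card_of_injective
      (fun a => ⟨Sum.inr a.1, congrArg _ a.2⟩) fun a b hab => ?_)
    exact Subtype.ext (Sum.inr_injective (congrArg Subtype.val hab))
  have surjective_G : Function.Surjective G := fun e => by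
    obtain ⟨⟨a, ha⟩⟩ := (Nat.card_pos_iff.1 ((Nat.zero_le _).trans_lt (hmany e e.departure))).1
    exact ⟨Sum.inr a, ha⟩
  obtain ⟨s, c, hs, hcyc⟩ := exists_cyclic_isArrangement hbalG hpos hlt
    (eqvGen_linked hD surjective_G)
  obtain ⟨r, -⟩ := exists_redPole (D.vertexAt (Classical.arbitrary Tet, 0))
  obtain ⟨e, -, he⟩ := hs.exists_not_cross (hlt r)
  obtain ⟨S, φ, hφ, hx⟩ := exists_redEdgeSequence_of_isArrangement (P := M + 2 * k)
    (by simp only [Nat.card_sum, Nat.card_fin]; omega) hs hcyc ⟨e, he⟩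
  exact ⟨S, RedEdgeSequence.arranges_of_equiv φ hφ, hx⟩

theorem exists_redEdgeSequence_isLeast_crossings [Nonempty Tet] (hD : D.Connected) {M : ℕ}
    {d : Fin M → D.OEdge} (hd : RedAdmissible d) {α : D.Vert → ℕ} (hα : ∀ T, 1 ≤ α T) :
    ∃ k ≤ ((⨆ T, α T) + D.maxLadderpoleMultiplicity * M / 2 + 1) * Nat.card Tet,
      ∃ (d' : Fin k → D.OEdge) (S : D.RedEdgeSequence (M + 2 * k)),
        (∀ j, D.color (d' j) = EdgeColor.red) ∧ S.Arranges d d' ∧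
        ∀ T : D.Vert, IsLeast {m : ℕ | ∃ l : D.Ladderpole,
          l.vertex = T ∧ l.color = EdgeColor.blue ∧ m = S.crossings l} (α T) := by
  obtain ⟨x, hle, hleast, hbal⟩ := exists_crossing_numbers
    (d := fun i => (⟨d i, hd.1 i⟩ : D.RedEdge)) hd.2 α
  obtain ⟨k, hk, d', hd'⟩ := exists_red_family D
    ((⨆ T, α T) + D.maxLadderpoleMultiplicity * M / 2 + 1)
  have hpos (r : D.RedPole) : 0 < x r := (hα _).trans ((hleast _).2 ⟨r, rfl, rfl⟩)
  have hmany (e : D.RedEdge) (r) : x r < Nat.card {a // withReverses d' a = e} := by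
    have := hle r
    have := hd' e
    have : α r.1.vertex ≤ ⨆ T, α T := le_ciSup (Set.finite_range α).bddAbove _
    omega
  obtain ⟨S, hS, hx⟩ := exists_redEdgeSequence hD hbal hpos hmany
  exact ⟨k, hk, fun j => (d' j).1, S, fun j => (d' j).2, hS,
    fun T => (RedEdgeSequence.isLeast_crossings_iff hx).2 (hleast T)⟩

end VeeringTriangulation

theorem mainTheorem7 {Tet : Type*} [Finite Tet] [Nonempty Tet] (D : VeeringTriangulation Tet)
    (hD : D.Connected) (M : ℕ) (d : Fin M → D.OEdge)
    (hd : VeeringTriangulation.RedAdmissible d) :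
    (∃ (k : ℕ) (d' : Fin k → D.OEdge) (S : D.RedEdgeSequence (M + 2 * k)),
      (∀ j, D.color (d' j) = EdgeColor.red) ∧ S.Arranges d d') ∧
    ∀ α : D.Vert → ℕ, (∀ T, 1 ≤ α T) →
      ∃ (k : ℕ) (d' : Fin k → D.OEdge) (S : D.RedEdgeSequence (M + 2 * k)),
        (∀ j, D.color (d' j) = EdgeColor.red) ∧ S.Arranges d d' ∧
        (∀ T : D.Vert, IsLeast
          {m : ℕ | ∃ l : D.Ladderpole,
            l.vertex = T ∧ l.color = EdgeColor.blue ∧ m = S.crossings l} (α T)) ∧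
        (k : ℚ) ≤ ((D.maxLadderpoleMultiplicity : ℚ) / 2 * (M : ℚ) + ((⨆ T, α T : ℕ) : ℚ) + 1)
          * (Nat.card Tet : ℚ) + (M : ℚ) := by
  refine ⟨?_, fun α hα => ?_⟩
  · obtain ⟨k, -, d', S, hred, hS, -⟩ :=
      VeeringTriangulation.exists_redEdgeSequence_isLeast_crossings hD hd fun _ => le_refl 1
    exact ⟨k, d', S, hred, hS⟩
  · obtain ⟨k, hk, d', S, hred, hS, hleast⟩ :=
      VeeringTriangulation.exists_redEdgeSequence_isLeast_crossings hD hd hα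
    refine ⟨k, d', S, hred, hS, hleast, ?_⟩
    have bound : (k : ℚ) ≤
        ((⨆ T, α T : ℕ) + (D.maxLadderpoleMultiplicity * M / 2 : ℕ) + 1) * Nat.card Tet := by
      exact_mod_cast hk
    have half_le : ((D.maxLadderpoleMultiplicity * M / 2 : ℕ) : ℚ) ≤
        D.maxLadderpoleMultiplicity / 2 * M :=
      Nat.cast_div_le.trans_eq (by push_cast; ring)
    refine bound.trans (le_add_of_le_of_nonneg ?_ M.cast_nonneg)
    gcongr ?_ * _
    linarith
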